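/- An $n\times n$ sign pattern $\mathcal P=[p_{ij}]$ is a matrix with entries in $\{+,-,0\}$; its qualitative class $\mathcal Q(\mathcal P)$ is the set of all real $n\times n$ matrices $A=[a_{ij}]$ with $\operatorname{sgn}(a_{ij})=p_{ij}$ for all $i,j$. The pattern $\mathcal P$ is consistent if there is an integer $k$ with $0\le k\le n$ such that every $A\in\mathcal Q(\mathcal P)$ has exactly $k$ real eigenvalues, counted with algebraic multiplicity. It is combinatorially symmetric if $p_{ij}\ne 0\iff p_{ji}\neq 0$ for all $i,j$; in that case, if the diagonal is zero, its underlying signed undirected graph $G$ has vertices $1,\dots,n$ and an edge $\{i,j\}$ whenever $p_{ij}\ne0$, the edge being positive or negative according to the sign of $p_{ij}p_{ji}$. Cycles of $G$ are simple cycles of length at least $3$, and two cycles are identified if they have the same vertices and edges. Two different cycles $\mathcal C_1,\mathcal C_2$ of $G$ are path-adjacent if there is a path $u\,v_1\cdots v_r\,w$ in $G$ ($r\ge0$, all vertices distinct) with $u\in V(\mathcal C_1)$, $w\in V(\mathcal C_2)$, such that none of $v_1,\dots,v_r$ is a vertex of a cycle of $G$. The distance between two cycles is the least distance in $G$ between a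 vertex of the one and a vertex of the other. A maximal signed path of a cycle $\mathcal C$ is a path consisting of one or more consecutive edges of $\mathcal C$ (in the cyclic order), all of the same sign, such that the edge of $\mathcal C$ preceding it and the edge of $\mathcal C$ following it both have the opposite sign. Two edges are nonadjacent if they have no common vertex. **Theorem.** Let $\mathcal P$ be an irreducible, combinatorially symmetric $n\times n$ sign pattern with zero diagonal. Suppose that its underlying signed undirected graph $G$ has at least one cycle, has no leaf (vertex of degree one), and that the distance between any two path-adjacent cycles of $G$ is odd. Then $\mathcal P$ is not consistent if any one of the following holds: 1. $G$ has a cycle with at least two nonadjacent positive edges; 2. $G$ has a cycle with more than one maximal signed path of odd length; 3. $G$ has a cycle of odd length with at least one positive edge. -/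

import Mathlib

/-- An `n × n` sign pattern: a matrix with entries in `{+, -, 0}`. -/
abbrev SignPattern (n : ℕ) : Type := Matrix (Fin n) (Fin n) SignType

namespace SignPattern

variable {n : ℕ}

/-- The qualitative class of a sign pattern. -/
def qualitativeClass (P : SignPattern n) : Set (Matrix (Fin n) (Fin n) ℝ) :=
  {A | ∀ i j, SignType.sign (A i j) = P i j}

/-- The number of real eigenvalues of a real matrix, counted with algebraic multiplicity
(`roots` is the multiset of the real roots of the characteristic polynomial). -/
noncomputable def numRealEigenvalues (A : Matrix (Fin n) (Fin n) ℝ) : ℕ :=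
  Multiset.card A.charpoly.roots

/-- Every matrix in the qualitative class has exactly `k` real eigenvalues. -/
def IsKConsistent (P : SignPattern n) (k : ℕ) : Prop :=
  ∀ A ∈ P.qualitativeClass, numRealEigenvalues A = k

def IsConsistent (P : SignPattern n) : Prop :=
  ∃ k, k ≤ n ∧ P.IsKConsistent k

/-- No simultaneous permutation of rows and columns brings `P` to a block triangular form with
two nonempty diagonal blocks: there is no nonempty proper set `S` of indices such that the block
with rows in `S` and columns outside `S` is zero. -/
def IsIrreducible (P : SignPattern n) : Prop :=
  ∀ S : Set (Fin n), S.Nonempty → S ≠ Set.univ → ∃ i ∈ S, ∃ j ∉ S, P i j ≠ 0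

def IsCombinatoriallySymmetric (P : SignPattern n) : Prop :=
  ∀ i j, P i j ≠ 0 ↔ P j i ≠ 0

def HasZeroDiagonal (P : SignPattern n) : Prop :=
  ∀ i, P i i = 0

/-- The underlying undirected graph of a combinatorially symmetric sign pattern with a zero
diagonal: `{i, j}` is an edge iff `p_ij` and `p_ji` are nonzero. -/
def graph (P : SignPattern n) : SimpleGraph (Fin n) where
  Adj i j := i ≠ j ∧ P i j * P j i ≠ 0
  symm := ⟨fun i j h => ⟨h.1.symm, by rw [mul_comm]; exact h.2⟩⟩
  loopless := ⟨fun _ h => h.1 rfl⟩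

instance (P : SignPattern n) : DecidableRel P.graph.Adj :=
  fun i j => inferInstanceAs (Decidable (i ≠ j ∧ P i j * P j i ≠ 0))

/-- The sign of the edge `{i, j}` is `p_ij * p_ji`. -/
def edgeSign (P : SignPattern n) : Sym2 (Fin n) → SignType :=
  Sym2.lift ⟨fun i j => P i j * P j i, fun i j => mul_comm (P i j) (P j i)⟩

/-- The edge of a closed walk at position `i`, where positions are read modulo the length. -/
def cyclicEdge {G : SimpleGraph (Fin n)} {u : Fin n} (c : G.Walk u u) (i : ℕ) : Sym2 (Fin n) :=
  s(c.getVert (i % c.length), c.getVert (i % c.length + 1))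

/-- The arc of the cycle `c` that consists of the `m` consecutive edges at the cyclic positions
`i, i + 1, …, i + m - 1` is a maximal signed path of `c`: it is a path (`m < c.length`) with at
least one edge, its edges have a common sign, and both the edge of `c` preceding it and the edge
of `c` following it have a different sign. -/
def IsMaximalSignedPath (P : SignPattern n) {u : Fin n} (c : P.graph.Walk u u) (i m : ℕ) : Prop :=
  i < c.length ∧ 0 < m ∧ m < c.length ∧
    ∃ s : SignType, (∀ t < m, P.edgeSign (cyclicEdge c (i + t)) = s) ∧
      P.edgeSign (cyclicEdge c (i + (c.length - 1))) ≠ s ∧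
      P.edgeSign (cyclicEdge c (i + m)) ≠ s

/-- `c` has more than one maximal signed path of odd length. An arc that is a maximal signed path
is determined by its initial position, so two such arcs are different iff these positions are. -/
def HasTwoOddMaximalSignedPaths (P : SignPattern n) {u : Fin n} (c : P.graph.Walk u u) : Prop :=
  ∃ i j m l, i ≠ j ∧ Odd m ∧ Odd l ∧ P.IsMaximalSignedPath c i m ∧ P.IsMaximalSignedPath c j l

/-- `c` has two positive edges without a common vertex. -/
def HasTwoNonadjacentPositiveEdges (P : SignPattern n) {u : Fin n} (c : P.graph.Walk u u) : Prop :=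
  ∃ e ∈ c.edges, ∃ f ∈ c.edges,
    P.edgeSign e = 1 ∧ P.edgeSign f = 1 ∧ ∀ v, ¬ (v ∈ e ∧ v ∈ f)

def HasPositiveEdge (P : SignPattern n) {u : Fin n} (c : P.graph.Walk u u) : Prop :=
  ∃ e ∈ c.edges, P.edgeSign e = 1

end SignPattern

namespace SimpleGraph

variable {V : Type*} {G : SimpleGraph V}

/-- Two different cycles (as subgraphs, that is, regardless of base point and direction) are
path-adjacent if there is a path `u v₁ ⋯ v_r w` with `r ≥ 0`, with `u` on the first and `w` on the
second cycle, none of whose inner vertices `v₁, …, v_r` lies on a cycle of the graph. -/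
def PathAdjacent {a b : V} (c₁ : G.Walk a a) (c₂ : G.Walk b b) : Prop :=
  c₁.toSubgraph ≠ c₂.toSubgraph ∧
    ∃ u ∈ c₁.support, ∃ w ∈ c₂.support, u ≠ w ∧ ∃ p : G.Walk u w, p.IsPath ∧
      ∀ v ∈ p.support, v ≠ u → v ≠ w →
        ∀ (x : V) (c : G.Walk x x), c.IsCycle → v ∉ c.support

/-- The distance between two closed walks: the least distance between a vertex of the first and a
vertex of the second. -/
noncomputable def cycleDist {a b : V} (c₁ : G.Walk a a) (c₂ : G.Walk b b) : ℕ :=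
  sInf {d | ∃ u ∈ c₁.support, ∃ w ∈ c₂.support, G.dist u w = d}

end SimpleGraph

/-! A subordinate matrix, whose nonzero entries obey the pattern, is a limit of members of the
qualitative class. Its simple real roots survive a small perturbation by a sign change, its nonreal
ones because being nonreal is an open condition. If every member has exactly `k` real eigenvalues,
then `k` is at least the number of simple real eigenvalues of any subordinate matrix, and at most
the number of real eigenvalues of a subordinate matrix with simple spectrum. Two subordinate
matrices with conflicting counts refute consistency.

The distance hypothesis supplies them. It makes distinct cycles vertex-disjoint. As there are no
leaves, every neighbour of a vertex `v` on no cycle starts a branch leading to a cycle. Two branches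
of lengths `l₁`, `l₂` join through `v` to a shortest path of length `l₁ + l₂ + 2` between different
cycles, so `l₁ + l₂` is odd. Hence exactly one neighbour has a branch of odd length; pairing `v`
with it gives a perfect matching off the cycles (`exists_matching_perm`). So the complement of any
cycle is spanned by disjoint cycles and edges (`realizable_compl_cycle`). A directed `m`-cycle with
weights of modulus `t` has characteristic polynomial `X ^ m ∓ t ^ m`, and different `t` keep the
spectra of disjoint blocks apart.

With the complement fixed, a cycle of length `m`, directed, is compared with positive edges on it,
each giving the eigenvalues `±t` (`not_isConsistent_of_card_roots_lt`). Two disjoint positive edges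
give four real eigenvalues against at most two; for odd `m` one positive edge gives two against at
most one. In the remaining case `m` is even and an odd maximal signed path forces exactly one
positive edge. The signs of the two orientations then have product `-1`, and the negative
orientation has no real eigenvalue. -/

open Polynomial Filter Topology

/-! ### Persistence and counting of polynomial roots -/

/-- Points that approximate the elements of a finite subset `S` of an open set `O` closely enough
are at least as many as the elements of `S`, even when only those in `O` are counted. -/
theorem Finset.exists_pos_card_le_of_approx {α : Type*} [MetricSpace α] (S : Finset α) (O : Set α)
    (hO : IsOpen O) (hS : ∀ x ∈ S, x ∈ O) :
    ∃ δ > 0, ∀ T : Finset α, (∀ x ∈ S, ∃ y ∈ T, dist y x < δ) →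
      ∃ T' ⊆ T, (∀ y ∈ T', y ∈ O) ∧ S.card ≤ T'.card := by
  classical
  have h1 : ∀ᶠ δ in 𝓝[>] (0 : ℝ), ∀ x ∈ S, Metric.ball x δ ⊆ O := by
    rw [Filter.eventually_all_finset]
    intro x hx
    obtain ⟨ε, hε, hb⟩ := Metric.isOpen_iff.1 hO x (hS x hx)
    filter_upwards [Ioo_mem_nhdsGT hε] with δ hδ
    exact (Metric.ball_subset_ball hδ.2.le).trans hb
  -- With distinct points at least `2δ` apart, no point approximates two of them.
  have h2 : ∀ᶠ δ in 𝓝[>] (0 : ℝ), ∀ x ∈ S, ∀ y ∈ S, x ≠ y → δ + δ ≤ dist x y := by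
    rw [Filter.eventually_all_finset]
    intro x _
    rw [Filter.eventually_all_finset]
    intro y _
    by_cases hxy : x = y
    · exact Filter.Eventually.of_forall fun _ h => absurd hxy h
    · have : 0 < dist x y / 2 := half_pos (dist_pos.2 hxy)
      filter_upwards [Ioo_mem_nhdsGT this] with δ hδ _
      linarith [hδ.2]
  obtain ⟨δ, ⟨hb, hs⟩, hδ⟩ := ((h1.and h2).and self_mem_nhdsWithin).exists
  refine ⟨δ, hδ, fun T hT => ?_⟩
  choose! f hfT hfd using hT
  refine ⟨S.image f, ?_, ?_, ?_⟩
  · intro y hy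
    obtain ⟨x, hx, rfl⟩ := Finset.mem_image.1 hy
    exact hfT x hx
  · intro y hy
    obtain ⟨x, hx, rfl⟩ := Finset.mem_image.1 hy
    exact hb x hx (hfd x hx)
  · rw [Finset.card_image_of_injOn]
    intro x hx y hy hxy
    by_contra hne
    have h3 := hs x hx y hy hne
    have h4 := hfd x hx
    have h5 := hfd y hy
    have h6 := dist_triangle_left x y (f x)
    rw [← hxy] at h5
    linarith

/-- A monic complex polynomial that is small at `z` has a root near `z`. -/
theorem Polynomial.Monic.exists_root_dist_lt {p : ℂ[X]} (hp : p.Monic) {z : ℂ} {δ : ℝ}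
    (hδ : 0 < δ) (h : ‖p.eval z‖ < δ ^ p.natDegree) : ∃ y ∈ p.roots, dist y z < δ := by
  by_contra! hcon
  have hsp := IsAlgClosed.splits p
  have h1 : p = (p.roots.map fun x => X - C x).prod := by
    conv_lhs => rw [hsp.eq_prod_roots, hp.leadingCoeff, C_1, one_mul]
  -- If all roots are at distance at least `δ` from `z`, every linear factor has norm at least `δ`
  -- there.
  have h2 : ∀ s : Multiset ℂ, (∀ y ∈ s, δ ≤ dist y z) →
      δ ^ s.card ≤ ‖((s.map fun x => X - C x).prod).eval z‖ := by
    intro s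
    induction s using Multiset.induction_on with
    | empty => simp
    | cons a s ih =>
      intro hs
      have ha := hs a (Multiset.mem_cons_self a s)
      have ih' := ih fun y hy => hs y (Multiset.mem_cons_of_mem hy)
      rw [dist_comm, dist_eq_norm] at ha
      simp only [Multiset.card_cons, Multiset.map_cons, Multiset.prod_cons, eval_mul, norm_mul,
        eval_sub, eval_X, eval_C, pow_succ']
      gcongr
  have h3 := h2 p.roots hcon
  rw [← h1, ← hsp.natDegree_eq_card_roots] at h3
  linarith

/-- Near a simple root, a polynomial takes values of opposite signs. -/
theorem Polynomial.exists_eval_mul_eval_neg {h : ℝ[X]} {x δ : ℝ} (hδ : 0 < δ)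
    (hx : h.eval x ≠ 0) :
    ∃ a b, x - δ < a ∧ a < b ∧ b < x + δ ∧
      ((X - C x) * h).eval a * ((X - C x) * h).eval b < 0 := by
  have h1 : Tendsto (fun r : ℝ => h.eval (x - r) * h.eval (x + r)) (𝓝[>] 0)
      (𝓝 (h.eval x * h.eval x)) := by
    have : Continuous (fun r : ℝ => h.eval (x - r) * h.eval (x + r)) := by fun_prop
    have h2 := this.tendsto 0
    simp only [sub_zero, add_zero] at h2
    exact h2.mono_left nhdsWithin_le_nhds
  obtain ⟨r, hr, hr0, hrδ⟩ := ((h1.eventually_const_lt (mul_self_pos.2 hx)).and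
    (Ioo_mem_nhdsGT hδ)).exists
  refine ⟨x - r, x + r, by linarith, by linarith, by linarith, ?_⟩
  simp only [eval_mul, eval_sub, eval_X, eval_C]
  have : (x - r - x) * h.eval (x - r) * ((x + r - x) * h.eval (x + r)) =
      -(r * r * (h.eval (x - r) * h.eval (x + r))) := by ring
  rw [this]
  have := mul_pos (mul_pos hr0 hr0) hr
  linarith

theorem Polynomial.exists_root_of_eval_mul_eval_neg {p : ℝ[X]} {a b : ℝ} (hab : a < b)
    (h : p.eval a * p.eval b < 0) : ∃ y, a < y ∧ y < b ∧ p.eval y = 0 := by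
  have hc : ContinuousOn (fun x => p.eval x) (Set.Icc a b) := p.continuous.continuousOn
  rcases mul_neg_iff.1 h with ⟨h1, h2⟩ | ⟨h1, h2⟩
  · obtain ⟨y, hy, hy0⟩ := intermediate_value_Ioo' hab.le hc ⟨h2, h1⟩
    exact ⟨y, hy.1, hy.2, hy0⟩
  · obtain ⟨y, hy, hy0⟩ := intermediate_value_Ioo hab.le hc ⟨h1, h2⟩
    exact ⟨y, hy.1, hy.2, hy0⟩

/-- Distinct nonreal roots of a real polynomial are counted apart from its real roots. -/
theorem Polynomial.card_roots_add_card_nonreal_le {p : ℝ[X]} (hp : p ≠ 0) (T : Finset ℂ)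
    (hT : ∀ z ∈ T, z ∈ (p.map Complex.ofRealHom).roots) (hT' : ∀ z ∈ T, z.im ≠ 0) :
    Multiset.card p.roots + T.card ≤ p.natDegree := by
  classical
  have hp' : p.map Complex.ofRealHom ≠ 0 := (Polynomial.map_ne_zero_iff
    Complex.ofRealHom.injective).2 hp
  have h1 : p.roots.map Complex.ofRealHom ≤
      (p.map Complex.ofRealHom).roots.filter (fun z => z.im = 0) := by
    rw [Multiset.le_filter]
    refine ⟨map_roots_le hp', ?_⟩
    intro z hz
    obtain ⟨x, _, rfl⟩ := Multiset.mem_map.1 hz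
    simp
  have h2 : T.val ≤ (p.map Complex.ofRealHom).roots.filter (fun z => ¬ z.im = 0) := by
    rw [Multiset.le_filter]
    exact ⟨(Multiset.le_iff_subset T.nodup).2 fun z hz => hT z hz, fun z hz => hT' z hz⟩
  have h3 := add_le_add h1 h2
  rw [Multiset.filter_add_not] at h3
  have h4 := Multiset.card_le_card h3
  rw [Multiset.card_add, Multiset.card_map] at h4
  exact h4.trans (card_roots_map_le_natDegree p)

/-- A real polynomial without multiple complex roots has at least `deg p` minus the number of
its real roots nonreal roots. -/
theorem Polynomial.Separable.exists_nonreal_roots {p : ℝ[X]} (hp : p.Separable) :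
    ∃ T : Finset ℂ, (∀ z ∈ T, z ∈ (p.map Complex.ofRealHom).roots) ∧ (∀ z ∈ T, z.im ≠ 0) ∧
      p.natDegree ≤ Multiset.card p.roots + T.card := by
  classical
  have hp0 := hp.ne_zero
  have hp' : p.map Complex.ofRealHom ≠ 0 := (Polynomial.map_ne_zero_iff
    Complex.ofRealHom.injective).2 hp0
  have hnd := nodup_roots (hp.map (f := Complex.ofRealHom))
  set R := (p.map Complex.ofRealHom).roots.toFinset with hR
  have hcard : R.card = p.natDegree := by
    rw [hR, Multiset.toFinset_card_of_nodup hnd, IsAlgClosed.card_roots_eq_natDegree,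
      natDegree_map]
  refine ⟨R.filter (fun z => ¬ z.im = 0), ?_, ?_, ?_⟩
  · intro z hz
    exact Multiset.mem_toFinset.1 (Finset.mem_filter.1 hz).1
  · intro z hz
    exact (Finset.mem_filter.1 hz).2
  · rw [← hcard, ← Finset.card_filter_add_card_filter_not (s := R) (fun z : ℂ => z.im = 0)]
    gcongr
    refine le_trans ?_ (Multiset.toFinset_card_le p.roots)
    refine Finset.card_le_card_of_injOn Complex.re ?_ ?_
    · intro z hz
      obtain ⟨hz1, hz2⟩ := Finset.mem_filter.1 (Finset.mem_coe.1 hz)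
      have hz3 := (mem_roots'.1 (Multiset.mem_toFinset.1 hz1)).2
      have hz4 : z = Complex.ofRealHom z.re := by
        apply Complex.ext <;> simp [hz2]
      rw [hz4, IsRoot.def, eval_map_apply, map_eq_zero] at hz3
      simp only [Finset.mem_coe, Multiset.mem_toFinset]
      exact (mem_roots hp0).2 hz3
    · intro z hz w hw hzw
      have h1 := (Finset.mem_filter.1 (Finset.mem_coe.1 hz)).2
      have h2 := (Finset.mem_filter.1 (Finset.mem_coe.1 hw)).2
      exact Complex.ext hzw (h1.trans h2.symm)

/-! ### Subordinate matrices and bounds on the number of real eigenvalues -/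

namespace SignPattern

variable {n : ℕ} {P : SignPattern n}

/-- The matrix with entries `1`, `-1`, `0` in the qualitative class. -/
def signMatrix (P : SignPattern n) : Matrix (Fin n) (Fin n) ℝ :=
  Matrix.of fun i j => ((P i j : SignType) : ℝ)

/-- Every nonzero entry of `B` has the sign prescribed by the pattern. -/
def IsSubordinate (P : SignPattern n) (B : Matrix (Fin n) (Fin n) ℝ) : Prop :=
  ∀ i j, B i j ≠ 0 → SignType.sign (B i j) = P i j

theorem IsSubordinate.add_smul_mem {B : Matrix (Fin n) (Fin n) ℝ} (hB : P.IsSubordinate B) {ε : ℝ}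
    (hε : 0 < ε) : B + ε • P.signMatrix ∈ P.qualitativeClass := by
  intro i j
  have h := hB i j
  simp only [Matrix.add_apply, Matrix.smul_apply, signMatrix, Matrix.of_apply, smul_eq_mul]
  by_cases h0 : B i j = 0
  · rw [h0, zero_add]
    cases P i j <;> simp [hε]
  · specialize h h0
    rw [← h]
    rcases lt_or_gt_of_ne h0 with hlt | hgt
    · rw [sign_neg hlt]
      simp only [SignType.coe_neg_one]
      exact sign_neg (by linarith)
    · rw [sign_pos hgt]
      simp only [SignType.coe_one]
      exact sign_pos (by linarith)

theorem tendsto_eval_charpoly (B N : Matrix (Fin n) (Fin n) ℝ) (x : ℝ) :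
    Tendsto (fun ε : ℝ => (B + ε • N).charpoly.eval x) (𝓝[>] 0) (𝓝 (B.charpoly.eval x)) := by
  have hc : Continuous (fun ε : ℝ => (B + ε • N).charpoly.eval x) := by
    simp only [Matrix.eval_charpoly]
    fun_prop
  have := hc.tendsto 0
  simp only [zero_smul, add_zero] at this
  exact this.mono_left nhdsWithin_le_nhds

theorem tendsto_eval_map_charpoly (B N : Matrix (Fin n) (Fin n) ℝ) (z : ℂ) :
    Tendsto (fun ε : ℝ => ((B + ε • N).charpoly.map Complex.ofRealHom).eval z) (𝓝[>] 0)
      (𝓝 ((B.charpoly.map Complex.ofRealHom).eval z)) := by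
  have hc : Continuous (fun ε : ℝ => ((B + ε • N).charpoly.map Complex.ofRealHom).eval z) := by
    simp only [← Matrix.charpoly_map, Matrix.eval_charpoly]
    refine Continuous.matrix_det (continuous_const.sub ?_)
    refine continuous_matrix fun i j => ?_
    simp only [Matrix.map_apply, Matrix.add_apply, Matrix.smul_apply, Complex.ofRealHom_eq_coe]
    fun_prop
  have := hc.tendsto 0
  simp only [zero_smul, add_zero] at this
  exact this.mono_left nhdsWithin_le_nhds

/-- Simple real eigenvalues of a subordinate matrix persist under perturbation. -/
theorem IsKConsistent.card_simple_roots_le {k : ℕ} (hk : P.IsKConsistent k)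
    {B : Matrix (Fin n) (Fin n) ℝ} (hB : P.IsSubordinate B) (S : Finset ℝ)
    (hS : ∀ x ∈ S, ∃ h : ℝ[X], B.charpoly = (X - C x) * h ∧ h.eval x ≠ 0) : S.card ≤ k := by
  classical
  obtain ⟨δ, hδ, hT⟩ := S.exists_pos_card_le_of_approx Set.univ isOpen_univ (by simp)
  have h1 : ∀ᶠ ε in 𝓝[>] (0 : ℝ), ∀ x ∈ S,
      ∃ y ∈ (B + ε • P.signMatrix).charpoly.roots.toFinset, dist y x < δ := by
    rw [Filter.eventually_all_finset]
    intro x hx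
    obtain ⟨h, hh, hx0⟩ := hS x hx
    obtain ⟨a, b, ha, hab, hb, hlt⟩ := exists_eval_mul_eval_neg hδ hx0
    rw [← hh] at hlt
    have := ((tendsto_eval_charpoly B P.signMatrix a).mul
      (tendsto_eval_charpoly B P.signMatrix b)).eventually_lt_const hlt
    filter_upwards [this] with ε hε
    obtain ⟨y, hay, hyb, hy⟩ := exists_root_of_eval_mul_eval_neg hab hε
    refine ⟨y, ?_, ?_⟩
    · rw [Multiset.mem_toFinset, mem_roots (Matrix.charpoly_monic _).ne_zero]
      exact hy
    · rw [Real.dist_eq, abs_lt]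
      constructor <;> linarith
  obtain ⟨ε, h2, hε⟩ := (h1.and self_mem_nhdsWithin).exists
  obtain ⟨T', hT', -, hc⟩ := hT _ h2
  have h3 := hk _ (hB.add_smul_mem hε)
  rw [numRealEigenvalues] at h3
  rw [← h3]
  exact (hc.trans (Finset.card_le_card hT')).trans (Multiset.toFinset_card_le _)

/-- Nonreal eigenvalues of a subordinate matrix persist under perturbation. -/
theorem IsKConsistent.add_card_nonreal_le {k : ℕ} (hk : P.IsKConsistent k)
    {B : Matrix (Fin n) (Fin n) ℝ} (hB : P.IsSubordinate B) (S : Finset ℂ)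
    (hS : ∀ z ∈ S, z ∈ (B.charpoly.map Complex.ofRealHom).roots) (hS' : ∀ z ∈ S, z.im ≠ 0) :
    k + S.card ≤ n := by
  classical
  have hO : IsOpen {z : ℂ | z.im ≠ 0} := isOpen_ne_fun Complex.continuous_im continuous_const
  obtain ⟨δ, hδ, hT⟩ := S.exists_pos_card_le_of_approx _ hO hS'
  have h1 : ∀ᶠ ε in 𝓝[>] (0 : ℝ), ∀ x ∈ S,
      ∃ y ∈ ((B + ε • P.signMatrix).charpoly.map Complex.ofRealHom).roots.toFinset,
        dist y x < δ := by
    rw [Filter.eventually_all_finset]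
    intro x hx
    have h0 : (B.charpoly.map Complex.ofRealHom).eval x = 0 := (mem_roots'.1 (hS x hx)).2
    have h2 := (tendsto_eval_map_charpoly B P.signMatrix x).norm
    rw [h0, norm_zero] at h2
    -- The threshold `δ ^ n` is the one that yields a root within `δ` for a monic polynomial of
    -- degree `n`.
    filter_upwards [h2.eventually_lt_const (pow_pos hδ n)] with ε hε
    obtain ⟨y, hy, hyd⟩ := ((Matrix.charpoly_monic (B + ε • P.signMatrix)).map
      Complex.ofRealHom).exists_root_dist_lt hδ (z := x) (by
        rw [natDegree_map, Matrix.charpoly_natDegree_eq_dim, Fintype.card_fin]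
        exact hε)
    exact ⟨y, Multiset.mem_toFinset.2 hy, hyd⟩
  obtain ⟨ε, h2, hε⟩ := (h1.and self_mem_nhdsWithin).exists
  obtain ⟨T', hT', hnr, hc⟩ := hT _ h2
  have h3 := hk _ (hB.add_smul_mem hε)
  rw [numRealEigenvalues] at h3
  have h4 := card_roots_add_card_nonreal_le (Matrix.charpoly_monic (B + ε • P.signMatrix)).ne_zero
    T' (fun z hz => Multiset.mem_toFinset.1 (hT' hz)) hnr
  rw [h3, Matrix.charpoly_natDegree_eq_dim, Fintype.card_fin] at h4
  linarith

/-- `g` is, up to a power of `X`, the characteristic polynomial of a subordinate matrix with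
support in `S × S`; it is separable and does not vanish at zero. -/
def Realizes (P : SignPattern n) (S : Finset (Fin n)) (g : ℝ[X]) : Prop :=
  g.Separable ∧ g.eval 0 ≠ 0 ∧ ∃ B : Matrix (Fin n) (Fin n) ℝ, P.IsSubordinate B ∧
    (∀ i j, B i j ≠ 0 → i ∈ S ∧ j ∈ S) ∧ B.charpoly * X ^ S.card = X ^ n * g

/-- `S` may be a proper subset: the unused indices only contribute a power of `X`, which leaves the
roots of `g`, all nonzero, simple. -/
theorem IsKConsistent.card_roots_le {k : ℕ} (hk : P.IsKConsistent k) {S : Finset (Fin n)}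
    {g : ℝ[X]} (hg : P.Realizes S g) : Multiset.card g.roots ≤ k := by
  classical
  obtain ⟨hsep, h0, B, hB, -, hchar⟩ := hg
  have hSn : S.card ≤ n := by simpa using S.card_le_univ
  have hchar' : B.charpoly = X ^ (n - S.card) * g := by
    apply mul_right_cancel₀ (pow_ne_zero S.card (X_ne_zero (R := ℝ)))
    rw [hchar]
    conv_lhs => rw [← Nat.sub_add_cancel hSn, pow_add]
    ring
  rw [← Multiset.toFinset_card_of_nodup (nodup_roots hsep)]
  refine hk.card_simple_roots_le hB _ fun x hx => ?_
  have hx1 : g.IsRoot x := (mem_roots'.1 (Multiset.mem_toFinset.1 hx)).2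
  obtain ⟨h, hh⟩ := dvd_iff_isRoot.2 hx1
  refine ⟨X ^ (n - S.card) * h, by rw [hchar', hh]; ring, ?_⟩
  have hx0 : x ≠ 0 := by
    rintro rfl
    exact h0 hx1
  rw [eval_mul, eval_pow, eval_X]
  refine mul_ne_zero (pow_ne_zero _ hx0) fun hx2 => ?_
  have h3 := hsep.eval₂_derivative_ne_zero (RingHom.id ℝ) (x := x) (by simpa using hx1)
  apply h3
  rw [hh]
  simp [eval₂_id, derivative_mul, hx2]

/-- All indices are needed here: a multiple eigenvalue zero could become nonreal under perturbation,
whereas a simple spectrum of full size has all its nonreal members counted. -/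
theorem IsKConsistent.le_card_roots {k : ℕ} (hk : P.IsKConsistent k)
    {g : ℝ[X]} (hg : P.Realizes Finset.univ g) : k ≤ Multiset.card g.roots := by
  obtain ⟨hsep, -, B, hB, -, hchar⟩ := hg
  rw [Finset.card_univ, Fintype.card_fin, mul_comm] at hchar
  have hchar' : B.charpoly = g := mul_left_cancel₀ (pow_ne_zero n (X_ne_zero (R := ℝ))) hchar
  obtain ⟨T, hT1, hT2, hT3⟩ := hsep.exists_nonreal_roots
  have h1 := hk.add_card_nonreal_le hB T (by rwa [hchar']) hT2
  rw [← hchar', Matrix.charpoly_natDegree_eq_dim, Fintype.card_fin] at hT3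
  rw [← hchar']
  linarith

theorem realizes_empty : P.Realizes ∅ 1 := by
  refine ⟨separable_one, by simp, 0, fun i j h => absurd rfl h, fun i j h => absurd rfl h, ?_⟩
  simp [Matrix.charpoly_zero]

/-- Disjoint supports give `A * B = 0`, hence `(X - A) * (X - B) = X * (X - (A + B))`; the identity
for the characteristic polynomials follows by taking determinants. -/
theorem Realizes.union {S T : Finset (Fin n)} {f g : ℝ[X]} (hf : P.Realizes S f)
    (hg : P.Realizes T g) (hST : Disjoint S T) (hfg : IsCoprime f g) :
    P.Realizes (S ∪ T) (f * g) := by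
  obtain ⟨hf1, hf2, A, hA, hAS, hAc⟩ := hf
  obtain ⟨hg1, hg2, B, hB, hBT, hBc⟩ := hg
  refine ⟨hf1.mul hg1 hfg, by rw [eval_mul]; exact mul_ne_zero hf2 hg2, A + B, ?_, ?_, ?_⟩
  · intro i j h
    by_cases hij : A i j = 0
    · rw [Matrix.add_apply, hij, zero_add] at h ⊢
      exact hB i j h
    · have : B i j = 0 := by
        by_contra hb
        exact Finset.disjoint_left.1 hST (hAS i j hij).1 (hBT i j hb).1
      rw [Matrix.add_apply, this, add_zero]
      exact hA i j hij
  · intro i j h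
    by_cases hij : A i j = 0
    · rw [Matrix.add_apply, hij, zero_add] at h
      exact ⟨Finset.mem_union_right _ (hBT i j h).1, Finset.mem_union_right _ (hBT i j h).2⟩
    · exact ⟨Finset.mem_union_left _ (hAS i j hij).1, Finset.mem_union_left _ (hAS i j hij).2⟩
  · have hAB : A * B = 0 := by
      ext i j
      rw [Matrix.mul_apply, Matrix.zero_apply]
      refine Finset.sum_eq_zero fun l _ => ?_
      by_contra hne
      exact Finset.disjoint_left.1 hST (hAS i l (left_ne_zero_of_mul hne)).2
        (hBT l j (right_ne_zero_of_mul hne)).1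
    have hmul : A.charmatrix * B.charmatrix = (X : ℝ[X]) • (A + B).charmatrix := by
      have hAB' : C.mapMatrix A * C.mapMatrix B = 0 := by rw [← map_mul, hAB, map_zero]
      simp only [Matrix.charmatrix, map_add, mul_sub, sub_mul, hAB', sub_zero]
      simp only [Matrix.scalar_apply, ← Matrix.smul_one_eq_diagonal, smul_mul_assoc, mul_smul_comm,
        one_mul, mul_one, smul_sub, smul_add]
      abel
    have hdet : A.charpoly * B.charpoly = X ^ n * (A + B).charpoly := by
      simp only [Matrix.charpoly]
      rw [← Matrix.det_mul, hmul, Matrix.det_smul, Fintype.card_fin]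
    rw [Finset.card_union_of_disjoint hST, pow_add]
    apply mul_left_cancel₀ (pow_ne_zero n (X_ne_zero (R := ℝ)))
    calc X ^ n * ((A + B).charpoly * (X ^ S.card * X ^ T.card))
        = (A.charpoly * X ^ S.card) * (B.charpoly * X ^ T.card) := by
          rw [← mul_assoc, ← hdet]; ring
      _ = X ^ n * (X ^ n * (f * g)) := by rw [hAc, hBc]; ring

end SignPattern

/-! ### Characteristic polynomials of weighted cycles -/

/-- A permutation that agrees at every point with a cycle `σ` or the identity is one of them. -/
theorem Equiv.Perm.IsCycle.eq_one_or_eq_of_forall {α : Type*} [Finite α] {σ τ : Equiv.Perm α}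
    (hσ : σ.IsCycle) (h : ∀ i, τ i = i ∨ τ i = σ i) : τ = 1 ∨ τ = σ := by
  rw [or_iff_not_imp_left]
  intro hne
  obtain ⟨x, hx⟩ : ∃ x, τ x ≠ x := by
    by_contra! hcon
    exact hne (Equiv.ext hcon)
  have hσx : τ x = σ x := (h x).resolve_left hx
  have hx' : σ x ≠ x := hσx ▸ hx
  -- Once `τ` follows `σ` at one point of the orbit it does so at the next, which it cannot fix by
  -- injectivity.
  have key : ∀ k : ℕ, τ ((σ ^ k) x) = σ ((σ ^ k) x) := by
    intro k
    induction k with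
    | zero => simpa using hσx
    | succ k ih =>
      rw [pow_succ', Equiv.Perm.mul_apply]
      refine (h _).resolve_left fun h1 => ?_
      have h2 := τ.injective (h1.trans ih.symm)
      rw [← Equiv.Perm.mul_apply, ← pow_succ', pow_succ, Equiv.Perm.mul_apply] at h2
      exact hx' ((σ ^ k).injective h2)
  ext y
  by_cases hy : σ y = y
  · rcases h y with h1 | h1
    · rw [h1, hy]
    · rw [h1]
  · obtain ⟨k, rfl⟩ := hσ.exists_pow_eq hx' hy
    exact key k

/-- The characteristic polynomial of a weighted cycle matrix. -/
theorem Matrix.charpoly_weighted_cycle {n : ℕ} {σ : Equiv.Perm (Fin n)} (hσ : σ.IsCycle)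
    (a : Fin n → ℝ) :
    (Matrix.of fun i j => if σ i = j ∧ i ≠ j then a i else 0).charpoly * X ^ σ.support.card =
      X ^ n * (X ^ σ.support.card - C (∏ i ∈ σ.support, a i)) := by
  classical
  set B : Matrix (Fin n) (Fin n) ℝ := Matrix.of fun i j => if σ i = j ∧ i ≠ j then a i else 0
    with hB
  have hdiag : ∀ i, B.charmatrix i i = X := by
    intro i
    simp [hB, Matrix.charmatrix_apply_eq]
  have hoff : ∀ i, σ i ≠ i → B.charmatrix i (σ i) = -C (a i) := by
    intro i hi
    rw [Matrix.charmatrix_apply_ne _ _ _ hi.symm]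
    simp [hB, hi.symm]
  have hzero : ∀ i j, j ≠ i → j ≠ σ i → B.charmatrix i j = 0 := by
    intro i j h1 h2
    rw [Matrix.charmatrix_apply_ne _ _ _ h1.symm]
    simp [hB, h2.symm]
  have hdet : B.charpoly = X ^ n +
      (Equiv.Perm.sign σ : ℤ) • ∏ i, B.charmatrix i (σ i) := by
    -- Row `i` is zero outside columns `i` and `σ i`, so only the permutations `1` and `σ`
    -- contribute. The transpose puts the factors in the form `B.charmatrix i (τ i)`.
    rw [Matrix.charpoly, ← Matrix.det_transpose, Matrix.det_apply,
      ← Finset.sum_subset (Finset.subset_univ {1, σ}), Finset.sum_pair hσ.ne_one.symm]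
    · simp [-Matrix.charmatrix_apply_eq, hdiag, Units.smul_def]
    · intro τ _ hτ
      simp only [Finset.mem_insert, Finset.mem_singleton, not_or] at hτ
      have : ∃ i, ¬ (τ i = i ∨ τ i = σ i) := by
        by_contra! hcon
        rcases hσ.eq_one_or_eq_of_forall hcon with h | h
        · exact hτ.1 h
        · exact hτ.2 h
      obtain ⟨i, hi⟩ := this
      rw [not_or] at hi
      rw [Finset.prod_eq_zero (Finset.mem_univ i), smul_zero]
      exact hzero _ _ hi.1 hi.2
  have hprod : (∏ i, B.charmatrix i (σ i)) * X ^ σ.support.card =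
      (-1) ^ σ.support.card * C (∏ i ∈ σ.support, a i) * X ^ n := by
    rw [← Finset.prod_mul_prod_compl σ.support]
    have h1 : ∏ i ∈ σ.support, B.charmatrix i (σ i) =
        (-1) ^ σ.support.card * C (∏ i ∈ σ.support, a i) := by
      rw [map_prod, ← Finset.prod_const, ← Finset.prod_mul_distrib]
      refine Finset.prod_congr rfl fun i hi => ?_
      rw [hoff i (Equiv.Perm.mem_support.1 hi), neg_one_mul]
    have h2 : ∏ i ∈ σ.supportᶜ, B.charmatrix i (σ i) = X ^ σ.supportᶜ.card := by
      rw [← Finset.prod_const]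
      refine Finset.prod_congr rfl fun i hi => ?_
      rw [Equiv.Perm.notMem_support.1 (Finset.mem_compl.1 hi), hdiag]
    rw [h1, h2, mul_assoc, ← pow_add, Finset.card_compl_add_card, Fintype.card_fin]
  have hs : (Equiv.Perm.sign σ : ℤ) = -(-1) ^ σ.support.card := by
    rw [hσ.sign]; simp
  rw [hdet, add_mul, smul_mul_assoc, hprod, hs]
  simp only [zsmul_eq_mul, Int.cast_neg, Int.cast_pow, Int.cast_one]
  have hsq : ((-1 : ℝ[X]) ^ σ.support.card) * (-1) ^ σ.support.card = 1 := by
    rw [← mul_pow]; simp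
  linear_combination (-C (∏ i ∈ σ.support, a i) * X ^ n) * hsq

theorem Polynomial.isCoprime_of_norm_roots {f g : ℝ[X]} {M : ℝ}
    (hf : ∀ z : ℂ, aeval z f = 0 → ‖z‖ ≤ M) (hg : ∀ z : ℂ, aeval z g = 0 → M < ‖z‖) :
    IsCoprime f g := by
  rw [isCoprime_iff_aeval_ne_zero_of_isAlgClosed ℝ ℂ]
  intro z
  by_contra! hcon
  exact absurd (hf z hcon.1) (not_le.2 (hg z hcon.2))

theorem Polynomial.exists_norm_roots_le {f : ℝ[X]} (hf : f ≠ 0) (M₀ : ℝ) :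
    ∃ M, M₀ ≤ M ∧ ∀ z : ℂ, aeval z f = 0 → ‖z‖ ≤ M := by
  obtain ⟨M, hM⟩ := ((rootSet_finite f ℂ).image norm).bddAbove
  refine ⟨max M₀ M, le_max_left _ _, fun z hz => le_max_of_le_right (hM ⟨z, ?_, rfl⟩)⟩
  exact (mem_rootSet_of_ne hf).2 hz

/-! ### Simple spectra on disjoint unions of directed cycles -/

namespace SignPattern

variable {n : ℕ} {P : SignPattern n}

/-- The sign of the directed cycle given by the permutation `σ`. -/
def cycleSign (P : SignPattern n) (σ : Equiv.Perm (Fin n)) : SignType :=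
  ∏ i ∈ σ.support, P i (σ i)

/-- The permutation moves every vertex either nowhere or along an edge. -/
def MovesAlongEdges (P : SignPattern n) (σ : Equiv.Perm (Fin n)) : Prop :=
  ∀ i, σ i ≠ i → P.graph.Adj i (σ i)

theorem MovesAlongEdges.inv {σ : Equiv.Perm (Fin n)} (h : P.MovesAlongEdges σ) :
    P.MovesAlongEdges σ⁻¹ := by
  intro i hi
  have h1 := h (σ⁻¹ i)
  rw [show σ (σ⁻¹ i) = i by simp] at h1
  exact (h1 hi.symm).symm

theorem MovesAlongEdges.cycleSign_ne_zero {σ : Equiv.Perm (Fin n)} (h : P.MovesAlongEdges σ) :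
    P.cycleSign σ ≠ 0 := by
  rw [cycleSign, Finset.prod_ne_zero_iff]
  intro i hi
  exact left_ne_zero_of_mul (h i (Equiv.Perm.mem_support.1 hi)).2

theorem norm_eq_of_aeval_eq_zero {s : SignType} (hs : s ≠ 0) {m : ℕ} (hm : m ≠ 0) {t : ℝ}
    (ht : 0 < t) {z : ℂ} (hz : aeval z (X ^ m - C ((s : ℝ) * t ^ m)) = 0) : ‖z‖ = t := by
  simp only [map_sub, map_pow, aeval_X, aeval_C, sub_eq_zero] at hz
  have h := congrArg norm hz
  rw [norm_pow, norm_algebraMap', norm_mul, norm_pow, Real.norm_of_nonneg ht.le] at h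
  have hs' : ‖(s : ℝ)‖ = 1 := by
    cases s
    · exact absurd rfl hs
    · simp
    · simp
  rw [hs', one_mul] at h
  exact (pow_left_inj₀ (norm_nonneg z) ht.le hm).1 h

/-- Giving every arc modulus `t` puts the whole nonzero spectrum on the circle of radius `t`, which
remains a free parameter for separating spectra. -/
theorem realizes_cycle {σ : Equiv.Perm (Fin n)} (hσ : σ.IsCycle) (hadj : P.MovesAlongEdges σ)
    {t : ℝ} (ht : 0 < t) :
    P.Realizes σ.support (X ^ σ.support.card - C ((P.cycleSign σ : ℝ) * t ^ σ.support.card)) := by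
  have hm : σ.support.card ≠ 0 := by have := hσ.two_le_card_support; omega
  have hs := hadj.cycleSign_ne_zero
  have hw : (P.cycleSign σ : ℝ) * t ^ σ.support.card ≠ 0 :=
    mul_ne_zero (by revert hs; cases P.cycleSign σ <;> simp) (pow_ne_zero _ ht.ne')
  refine ⟨separable_X_pow_sub_C _ (Nat.cast_ne_zero.2 hm) hw, by simp [hm, hw],
    Matrix.of fun i j => if σ i = j ∧ i ≠ j then (P i (σ i) : ℝ) * t else 0, ?_, ?_, ?_⟩
  · intro i j h
    simp only [Matrix.of_apply, ne_eq, ite_eq_right_iff, not_forall] at h ⊢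
    obtain ⟨⟨rfl, h1⟩, -⟩ := h
    rw [if_pos ⟨rfl, h1⟩, sign_mul, sign_pos ht, mul_one]
    cases P i (σ i) <;> simp
  · intro i j h
    simp only [Matrix.of_apply, ne_eq, ite_eq_right_iff, not_forall] at h
    obtain ⟨⟨rfl, h1⟩, -⟩ := h
    rw [Equiv.Perm.apply_mem_support, and_self, Equiv.Perm.mem_support]
    exact fun h => h1 h.symm
  · rw [Matrix.charpoly_weighted_cycle hσ, Finset.prod_mul_distrib, Finset.prod_const]
    have : (P.cycleSign σ : ℝ) = ∏ i ∈ σ.support, (P i (σ i) : ℝ) :=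
      map_prod (SignType.castHom (α := ℝ)) _ _
    rw [this]

/-- `S` supports subordinate matrices with a simple nonzero spectrum of arbitrarily large
modulus and at least `e` nonzero real eigenvalues. -/
def Realizable (P : SignPattern n) (e : ℕ) (S : Finset (Fin n)) : Prop :=
  ∀ M : ℝ, ∃ g : ℝ[X], P.Realizes S g ∧ (∀ z : ℂ, aeval z g = 0 → M < ‖z‖) ∧
    e ≤ Multiset.card g.roots

theorem realizable_empty : P.Realizable 0 ∅ := fun _ => ⟨1, realizes_empty, by simp, by simp⟩

/-- The unbounded modulus in `Realizable` lets the spectrum on `T` be pushed outside a disc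
containing that on `S`, which makes the two polynomials coprime. -/
theorem Realizable.union {d e : ℕ} {S T : Finset (Fin n)} (hS : P.Realizable d S)
    (hT : P.Realizable e T) (h : Disjoint S T) : P.Realizable (d + e) (S ∪ T) := by
  intro M
  obtain ⟨f, hf, hfM, hfc⟩ := hS M
  obtain ⟨M', hM, hfM'⟩ := exists_norm_roots_le hf.1.ne_zero M
  obtain ⟨g, hg, hgM, hgc⟩ := hT M'
  refine ⟨f * g, hf.union hg h (isCoprime_of_norm_roots hfM' hgM), fun z hz => ?_, ?_⟩
  · rw [map_mul, mul_eq_zero] at hz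
    rcases hz with hz | hz
    · exact hfM z hz
    · exact hM.trans_lt (hgM z hz)
  · rw [roots_mul (mul_ne_zero hf.1.ne_zero hg.1.ne_zero), Multiset.card_add]
    exact add_le_add hfc hgc

theorem Realizable.biUnion {ι : Type*} [DecidableEq ι] (s : Finset ι) (f : ι → Finset (Fin n))
    (hf : ∀ i ∈ s, P.Realizable 0 (f i)) (hd : (s : Set ι).PairwiseDisjoint f) :
    P.Realizable 0 (s.biUnion f) := by
  induction s using Finset.induction_on with
  | empty => simpa using realizable_empty
  | insert a s ha ih =>
    rw [Finset.biUnion_insert]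
    refine (hf a (Finset.mem_insert_self a s)).union
      (ih (fun i hi => hf i (Finset.mem_insert_of_mem hi))
        (hd.subset (by simp))) ?_
    rw [Finset.disjoint_biUnion_right]
    intro i hi
    exact hd (by simp) (by simp [hi]) (fun h => ha (h ▸ hi))

theorem realizable_of_isCycle {σ : Equiv.Perm (Fin n)} (hσ : σ.IsCycle)
    (hadj : P.MovesAlongEdges σ) : P.Realizable 0 σ.support := by
  intro M
  -- `M` may be negative; this radius is positive and exceeds `M` in any case.
  have ht : 0 < |M| + 1 := by positivity
  have hm : σ.support.card ≠ 0 := by have := hσ.two_le_card_support; omega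
  refine ⟨_, realizes_cycle hσ hadj ht, fun z hz => ?_, Nat.zero_le _⟩
  rw [norm_eq_of_aeval_eq_zero hadj.cycleSign_ne_zero hm ht hz]
  linarith [le_abs_self M]

theorem MovesAlongEdges.realizable {σ : Equiv.Perm (Fin n)} (h : P.MovesAlongEdges σ) :
    P.Realizable 0 σ.support := by
  revert h
  refine Equiv.Perm.cycle_induction_on (fun σ => P.MovesAlongEdges σ → P.Realizable 0 σ.support) σ
    (fun _ => by simpa using realizable_empty) (fun σ hσ hadj => realizable_of_isCycle hσ hadj) ?_
  intro σ τ hd _ hσ hτ hadj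
  rw [hd.support_mul]
  refine (hσ fun i hi => ?_).union (hτ fun i hi => ?_) hd.disjoint_support
  · have hτi : τ i = i := (hd i).resolve_left hi
    have := hadj i
    rw [Equiv.Perm.mul_apply, hτi] at this
    exact this hi
  · have hσi : σ i = i := (hd i).resolve_right hi
    have := hadj i
    rw [hd.commute.eq, Equiv.Perm.mul_apply, hσi] at this
    exact this hi

end SignPattern

/-! ### Bridges, disjoint cycles and the matching off the cycles -/

namespace SimpleGraph

variable {V : Type*} {G : SimpleGraph V}

/-- The vertex `v` lies on a cycle. -/
def OnCycle (G : SimpleGraph V) (v : V) : Prop :=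
  ∃ (x : V) (c : G.Walk x x), c.IsCycle ∧ v ∈ c.support

theorem isBridge_of_not_onCycle {v w : V} (hv : ¬ G.OnCycle v) (h : G.Adj v w) :
    G.IsBridge s(v, w) := by
  rw [isBridge_iff_forall_cycle_notMem h]
  intro x c hc he
  exact hv ⟨x, c, hc, c.fst_mem_support_of_mem_edges he⟩

/-- The edge from `v` to `w₁` is a bridge, so the detour through `w₂` and back along `q` must use
it. -/
theorem mem_support_of_not_onCycle {v w₁ w₂ : V} (hv : ¬ G.OnCycle v) (h₁ : G.Adj v w₁)
    (h₂ : G.Adj v w₂) (hne : w₁ ≠ w₂) (q : G.Walk w₁ w₂) : v ∈ q.support := by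
  have h := isBridge_iff_forall_walk_mem_edges.1 (isBridge_of_not_onCycle hv h₁)
    (Walk.cons h₂ q.reverse)
  rw [Walk.edges_cons, List.mem_cons, Walk.edges_reverse, List.mem_reverse] at h
  rcases h with h | h
  · rw [Sym2.eq_iff] at h
    rcases h with ⟨-, h⟩ | ⟨h, -⟩
    · exact absurd h hne
    · exact absurd h h₂.ne
  · exact q.fst_mem_support_of_mem_edges h

/-- A trail consisting of bridges is contained in every walk with the same ends. -/
theorem Walk.IsTrail.edges_subset_of_forall_isBridge {a b : V} {p : G.Walk a b} (hp : p.IsTrail)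
    (hb : ∀ e ∈ p.edges, G.IsBridge e) (q : G.Walk a b) : p.edges ⊆ q.edges := by
  induction p with
  | nil => simp
  | @cons a a' b h p' ih =>
    rw [Walk.isTrail_cons] at hp
    have h1 : s(a, a') ∈ q.edges := by
      -- The walk along `q` and back along `p'` joins the ends of the first bridge, and `p'` does
      -- not use it.
      have := isBridge_iff_forall_walk_mem_edges.1 (hb s(a, a') (by simp)) (q.append p'.reverse)
      rw [Walk.edges_append, List.mem_append, Walk.edges_reverse, List.mem_reverse] at this
      exact this.resolve_right hp.2
    have h2 := ih hp.1 (fun e he => hb e (by simp [he])) (Walk.cons h.symm q)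
    rw [Walk.edges_cons]
    refine List.cons_subset.2 ⟨h1, fun e he => ?_⟩
    have h3 := h2 he
    rw [Walk.edges_cons, List.mem_cons] at h3
    refine h3.resolve_left fun h4 => hp.2 ?_
    rw [Sym2.eq_swap, ← h4]
    exact he

theorem Walk.exists_subwalk_of_mem_support {u x z : V} (c : G.Walk u u) (hx : x ∈ c.support)
    (hz : z ∈ c.support) :
    ∃ w : G.Walk z x, w.edges ⊆ c.edges ∧ w.support ⊆ c.support := by
  classical
  have hx' : x ∈ (c.rotate z hz).support := (Walk.mem_support_rotate_iff c z hz).2 hx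
  refine ⟨(c.rotate z hz).takeUntil x hx', fun e he => ?_, fun y hy => ?_⟩
  · exact (c.rotate_edges z hz).mem_iff.1 (Walk.edges_takeUntil_subset_edges _ hx' he)
  · exact (Walk.mem_support_rotate_iff c z hz).1 (Walk.support_takeUntil_subset_support _ hx' hy)

/-- There is a path of length `l` from the neighbour `w` of `v` to a vertex on a cycle that avoids
`v` and none of whose earlier vertices lies on a cycle. -/
def Branch (G : SimpleGraph V) (v w : V) (l : ℕ) : Prop :=
  ∃ (z : V) (q : G.Walk w z), q.IsPath ∧ v ∉ q.support ∧
    (∀ x ∈ q.support, x ≠ z → ¬ G.OnCycle x) ∧ G.OnCycle z ∧ q.length = l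

/-- Path-adjacent cycles have an odd distance. -/
def OddCycleDist (G : SimpleGraph V) : Prop :=
  ∀ (a b : V) (c₁ : G.Walk a a) (c₂ : G.Walk b b),
    c₁.IsCycle → c₂.IsCycle → PathAdjacent c₁ c₂ → Odd (cycleDist c₁ c₂)

/-- Different cycles sharing `x` would be path-adjacent through an edge of `c₂` at `x`, a path
without inner vertices, while their distance is the even number zero. -/
theorem OddCycleDist.toSubgraph_eq (hG : G.OddCycleDist) {a b x : V} {c₁ : G.Walk a a}
    {c₂ : G.Walk b b} (h₁ : c₁.IsCycle) (h₂ : c₂.IsCycle) (hx₁ : x ∈ c₁.support)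
    (hx₂ : x ∈ c₂.support) : c₁.toSubgraph = c₂.toSubgraph := by
  classical
  by_contra hne
  have hc := (Walk.isCycle_rotate hx₂).2 h₂
  obtain ⟨y, hy, p, hp⟩ : ∃ (y : V) (h : G.Adj x y) (p : G.Walk y x),
      c₂.rotate x hx₂ = Walk.cons h p := by
    cases hr : c₂.rotate x hx₂ with
    | nil => exact absurd (hr ▸ hc) Walk.not_isCycle_nil
    | cons h p => exact ⟨_, h, p, rfl⟩
  have hy₂ : y ∈ c₂.support := by
    rw [← Walk.mem_support_rotate_iff c₂ x hx₂, hp]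
    simp
  have hodd := hG a b c₁ c₂ h₁ h₂ ⟨hne, x, hx₁, y, hy₂, hy.ne, hy.toWalk, by simp [hy.ne], by
    intro v hv hvx hvy
    simp at hv
    tauto⟩
  have h0 : cycleDist c₁ c₂ = 0 := Nat.sInf_eq_zero.2 (Or.inl ⟨x, hx₁, x, hx₂, dist_self⟩)
  rw [h0] at hodd
  exact absurd hodd (by decide)

theorem not_onCycle_of_mem_edges {w z : V} {q : G.Walk w z}
    (hq : ∀ x ∈ q.support, x ≠ z → ¬ G.OnCycle x) {e : Sym2 V} (he : e ∈ q.edges) :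
    ∃ x ∈ e, ¬ G.OnCycle x := by
  induction e using Sym2.ind with
  | _ a b =>
    have hab : a ≠ b := (q.adj_of_mem_edges he).ne
    by_cases ha : a = z
    · exact ⟨b, by simp, hq b (q.snd_mem_support_of_mem_edges he) (fun h => hab (ha.trans h.symm))⟩
    · exact ⟨a, by simp, hq a (q.fst_mem_support_of_mem_edges he) ha⟩

/-- A path between two cycles all of whose edges have an end on no cycle is shortest. -/
theorem cycleDist_eq_length {a b z₁ z₂ : V} {c₁ : G.Walk a a} {c₂ : G.Walk b b}
    (h₁ : c₁.IsCycle) (h₂ : c₂.IsCycle) (hz₁ : z₁ ∈ c₁.support) (hz₂ : z₂ ∈ c₂.support)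
    {p : G.Walk z₁ z₂} (hp : p.IsPath) (he : ∀ e ∈ p.edges, ∃ x ∈ e, ¬ G.OnCycle x) :
    cycleDist c₁ c₂ = p.length := by
  classical
  have hle : cycleDist c₁ c₂ ≤ G.dist z₁ z₂ := Nat.sInf_le ⟨z₁, hz₁, z₂, hz₂, rfl⟩
  refine le_antisymm (hle.trans (dist_le p)) ?_
  refine le_csInf ⟨G.dist z₁ z₂, z₁, hz₁, z₂, hz₂, rfl⟩ ?_
  rintro d ⟨x, hx, y, hy, rfl⟩
  obtain ⟨w₁, hw₁, -⟩ := c₁.exists_subwalk_of_mem_support hx hz₁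
  obtain ⟨w₂, hw₂, -⟩ := c₂.exists_subwalk_of_mem_support hz₂ hy
  have hr : G.Reachable x y :=
    ⟨(w₁.reverse.append p).append (w₂.reverse)⟩
  obtain ⟨q, hq⟩ := hr.exists_walk_length_eq_dist
  -- Extended along the two cycles, `q` joins the ends of `p` and so contains all its edges, which
  -- are bridges. The extensions contain none of them, since every edge of `p` has an end on no
  -- cycle.
  have hsub := hp.isTrail.edges_subset_of_forall_isBridge (fun e hep => ?_)
    ((w₁.append q).append w₂)
  · rw [← hq, ← p.length_edges, ← q.length_edges]
    refine (List.subperm_of_subset hp.isTrail.edges_nodup fun e hep => ?_).length_le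
    have h3 := hsub hep
    obtain ⟨v, hv, hvc⟩ := he e hep
    rw [Walk.edges_append, Walk.edges_append, List.mem_append, List.mem_append] at h3
    rcases h3 with (h3 | h3) | h3
    · exact absurd ⟨a, c₁, h₁, Walk.mem_support_of_mem_edges (hw₁ h3) hv⟩ hvc
    · exact h3
    · exact absurd ⟨b, c₂, h₂, Walk.mem_support_of_mem_edges (hw₂ h3) hv⟩ hvc
  · obtain ⟨v, hv, hvc⟩ := he e hep
    obtain ⟨w, rfl⟩ := hv
    exact isBridge_of_not_onCycle hvc (p.adj_of_mem_edges hep)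

/-- The branches meet neither each other nor the same cycle, for `v` separates `w₁` from `w₂`.
Joined through `v` they realize the distance `l₁ + l₂ + 2` of two different cycles. -/
theorem OddCycleDist.odd_add_of_branch (hG : G.OddCycleDist) {v w₁ w₂ : V} {l₁ l₂ : ℕ}
    (hv : ¬ G.OnCycle v) (h₁ : G.Adj v w₁) (h₂ : G.Adj v w₂) (hne : w₁ ≠ w₂)
    (hb₁ : G.Branch v w₁ l₁) (hb₂ : G.Branch v w₂ l₂) : Odd (l₁ + l₂) := by
  classical
  obtain ⟨z₁, q₁, hp₁, hv₁, hU₁, ⟨a, c₁, hc₁, hz₁⟩, rfl⟩ := hb₁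
  obtain ⟨z₂, q₂, hp₂, hv₂, hU₂, ⟨b, c₂, hc₂, hz₂⟩, rfl⟩ := hb₂
  have hdisj : ∀ x ∈ q₁.support, x ∉ q₂.support := by
    intro x hx₁ hx₂
    have := mem_support_of_not_onCycle hv h₁ h₂ hne
      ((q₁.takeUntil x hx₁).append (q₂.takeUntil x hx₂).reverse)
    rw [Walk.mem_support_append_iff, Walk.support_reverse, List.mem_reverse] at this
    rcases this with h | h
    · exact hv₁ (q₁.support_takeUntil_subset_support hx₁ h)
    · exact hv₂ (q₂.support_takeUntil_subset_support hx₂ h)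
  have hcc : c₁.toSubgraph ≠ c₂.toSubgraph := by
    intro heq
    have hz : z₂ ∈ c₁.support := by
      rw [← Walk.mem_verts_toSubgraph, heq, Walk.mem_verts_toSubgraph]
      exact hz₂
    obtain ⟨w, -, hw⟩ := c₁.exists_subwalk_of_mem_support hz hz₁
    have := mem_support_of_not_onCycle hv h₁ h₂ hne ((q₁.append w).append q₂.reverse)
    rw [Walk.mem_support_append_iff, Walk.mem_support_append_iff, Walk.support_reverse,
      List.mem_reverse] at this
    rcases this with (h | h) | h
    · exact hv₁ h
    · exact hv ⟨a, c₁, hc₁, hw h⟩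
    · exact hv₂ h
  set p : G.Walk z₁ z₂ := q₁.reverse.append (Walk.cons h₁.symm (Walk.cons h₂ q₂)) with hp
  have hsupp : p.support = q₁.support.reverse ++ v :: q₂.support := by
    rw [hp, Walk.support_append]
    simp
  have hpath : p.IsPath := by
    refine Walk.IsPath.mk' ?_
    rw [hsupp, List.nodup_append, List.nodup_reverse, List.nodup_cons]
    refine ⟨hp₁.support_nodup, ⟨hv₂, hp₂.support_nodup⟩, ?_⟩
    intro x hx y hy hxy
    subst hxy
    rw [List.mem_reverse] at hx
    rcases List.mem_cons.1 hy with rfl | hy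
    · exact hv₁ hx
    · exact hdisj x hx hy
  have hedge : ∀ e ∈ p.edges, ∃ x ∈ e, ¬ G.OnCycle x := by
    intro e he
    rw [hp, Walk.edges_append, List.mem_append, Walk.edges_reverse, List.mem_reverse,
      Walk.edges_cons, Walk.edges_cons, List.mem_cons, List.mem_cons] at he
    rcases he with he | rfl | rfl | he
    · exact not_onCycle_of_mem_edges hU₁ he
    · exact ⟨v, by simp, hv⟩
    · exact ⟨v, by simp, hv⟩
    · exact not_onCycle_of_mem_edges hU₂ he
  have hodd := hG a b c₁ c₂ hc₁ hc₂ ⟨hcc, z₁, hz₁, z₂, hz₂, ?_, p, hpath, ?_⟩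
  · rw [cycleDist_eq_length hc₁ hc₂ hz₁ hz₂ hpath hedge, hp, Walk.length_append,
      Walk.length_reverse, Walk.length_cons, Walk.length_cons] at hodd
    rw [Nat.odd_iff] at hodd ⊢
    omega
  · intro hz
    exact hdisj z₁ q₁.end_mem_support (hz ▸ q₂.end_mem_support)
  · intro x hx hxz₁ hxz₂ y c hc hxc
    rw [hsupp, List.mem_append, List.mem_reverse, List.mem_cons] at hx
    rcases hx with hx | rfl | hx
    · exact hU₁ x hx hxz₁ ⟨y, c, hc, hxc⟩
    · exact hv ⟨y, c, hc, hxc⟩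
    · exact hU₂ x hx hxz₂ ⟨y, c, hc, hxc⟩

theorem exists_branch [Fintype V] (hdeg : ∀ v w, G.Adj v w → ∃ w', G.Adj v w' ∧ w' ≠ w) {v w : V}
    (hv : ¬ G.OnCycle v) (h : G.Adj v w) : ∃ l, G.Branch v w l := by
  -- Without leaves a path that has not met a cycle can be prolonged; at length `Fintype.card V`
  -- this is impossible.
  have key : ∀ (k : ℕ) (v w : V), ¬ G.OnCycle v → G.Adj v w → (∃ l, G.Branch v w l) ∨
      ∃ (z : V) (q : G.Walk w z), q.IsPath ∧ v ∉ q.support ∧ q.length = k := by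
    intro k
    induction k with
    | zero =>
      intro v w hv h
      exact Or.inr ⟨w, Walk.nil, by simp, by simpa using h.ne, rfl⟩
    | succ k ih =>
      intro v w hv h
      by_cases hw : G.OnCycle w
      · exact Or.inl ⟨0, w, Walk.nil, by simp, by simpa using h.ne, by simp, hw, rfl⟩
      obtain ⟨w', hw', hne⟩ := hdeg w v h.symm
      -- A walk from `w'` to `v` has to pass through `w`, which lies on no cycle.
      have havoid : ∀ {z : V} (q : G.Walk w' z), w ∉ q.support → v ∉ q.support := by
        classical
        intro z q hq hvq
        exact hq (q.support_takeUntil_subset_support hvq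
          (mem_support_of_not_onCycle hw hw' h.symm hne (q.takeUntil v hvq)))
      rcases ih w w' hw hw' with ⟨l, z, q, hp, hwq, hU, hz, -⟩ | ⟨z, q, hp, hwq, hl⟩
      · refine Or.inl ⟨_, z, Walk.cons hw' q, hp.cons hwq, ?_, ?_, hz, rfl⟩
        · rw [Walk.support_cons, List.mem_cons, not_or]
          exact ⟨h.ne, havoid q hwq⟩
        · intro x hx hxz
          rw [Walk.support_cons, List.mem_cons] at hx
          rcases hx with rfl | hx
          · exact hw
          · exact hU x hx hxz
      · refine Or.inr ⟨z, Walk.cons hw' q, hp.cons hwq, ?_, by rw [Walk.length_cons, hl]⟩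
        rw [Walk.support_cons, List.mem_cons, not_or]
        exact ⟨h.ne, havoid q hwq⟩
  rcases key (Fintype.card V) v w hv h with h1 | ⟨z, q, hq, -, hl⟩
  · exact h1
  · exact absurd hq.length_lt (by omega)

/-- The vertices that lie on no cycle have a perfect matching. -/
theorem OddCycleDist.exists_matching_perm [Fintype V] (hG : G.OddCycleDist)
    (hdeg : ∀ v w, G.Adj v w → ∃ w', G.Adj v w' ∧ w' ≠ w) (hdeg' : ∀ v, ∃ w, G.Adj v w) :
    ∃ σ : Equiv.Perm V, (∀ v, σ v ≠ v ↔ ¬ G.OnCycle v) ∧ ∀ v, σ v ≠ v → G.Adj v (σ v) := by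
  classical
  have hex : ∀ v, ¬ G.OnCycle v → ∃ w, G.Adj v w ∧ ∃ l, Odd l ∧ G.Branch v w l := by
    intro v hv
    obtain ⟨w, hw⟩ := hdeg' v
    obtain ⟨w', hw', hne⟩ := hdeg v w hw
    obtain ⟨l, hl⟩ := exists_branch hdeg hv hw
    obtain ⟨l', hl'⟩ := exists_branch hdeg hv hw'
    have hodd := hG.odd_add_of_branch hv hw hw' hne.symm hl hl'
    by_cases h : Odd l
    · exact ⟨w, hw, l, h, hl⟩
    · refine ⟨w', hw', l', ?_, hl'⟩
      rw [Nat.odd_iff] at *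
      omega
  have huniq : ∀ v w w', ¬ G.OnCycle v → G.Adj v w → G.Adj v w' →
      (∃ l, Odd l ∧ G.Branch v w l) → (∃ l, Odd l ∧ G.Branch v w' l) → w = w' := by
    rintro v w w' hv hw hw' ⟨l, hl, hb⟩ ⟨l', hl', hb'⟩
    by_contra hne
    have hodd := hG.odd_add_of_branch hv hw hw' hne hb hb'
    rw [Nat.odd_iff] at *
    omega
  -- Symmetry of the pairing: an odd branch has positive length, so `w` is on no cycle. Without its
  -- first edge it is a branch of even length at `w`, so the branch at `w` through `v` is odd.
  have hback : ∀ v w, ¬ G.OnCycle v → G.Adj v w → (∃ l, Odd l ∧ G.Branch v w l) →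
      ¬ G.OnCycle w ∧ ∃ l, Odd l ∧ G.Branch w v l := by
    rintro v w hv hvw ⟨l, hl, z, q, hp, hvq, hU, hz, hlen⟩
    cases q with
    | nil =>
      rw [← hlen] at hl
      exact absurd hl (by simp)
    | @cons _ w' _ h q =>
      rw [Walk.cons_isPath_iff] at hp
      have hw : ¬ G.OnCycle w := hU w (by simp) fun h1 => hp.2 (by
        rw [h1]
        exact q.end_mem_support)
      refine ⟨hw, ?_⟩
      obtain ⟨l', hl'⟩ := exists_branch hdeg hw hvw.symm
      refine ⟨l', ?_, hl'⟩
      have hne : v ≠ w' := by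
        rintro rfl
        exact hvq (by simp)
      have hodd := hG.odd_add_of_branch hw hvw.symm h hne hl'
        ⟨z, q, hp.1, hp.2, fun x hx hxz => hU x (by simp [hx]) hxz, hz, rfl⟩
      rw [Walk.length_cons] at hlen
      rw [Nat.odd_iff] at *
      omega
  choose! f hfadj hfodd using hex
  let g : V → V := fun v => if G.OnCycle v then v else f v
  have hgU : ∀ v, ¬ G.OnCycle v → g v = f v := fun v hv => if_neg hv
  have hinv : Function.Involutive g := by
    intro v
    by_cases hv : G.OnCycle v
    · have : g v = v := if_pos hv
      rw [this, this]
    · obtain ⟨hw, hb⟩ := hback v (f v) hv (hfadj v hv) (hfodd v hv)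
      rw [hgU v hv, hgU _ hw]
      exact huniq (f v) _ _ hw (hfadj _ hw) (hfadj v hv).symm (hfodd _ hw) hb
  have hmove : ∀ v, g v ≠ v ↔ ¬ G.OnCycle v := by
    intro v
    by_cases hv : G.OnCycle v
    · simp [g, hv]
    · rw [hgU v hv]
      exact iff_of_true (hfadj v hv).ne' hv
  refine ⟨hinv.toPerm g, hmove, fun v hv => ?_⟩
  have hv' := (hmove v).1 hv
  change G.Adj v (g v)
  rw [hgU v hv']
  exact hfadj v hv'

/-- The permutation that moves every vertex of a cycle to the next one. -/
theorem Walk.IsCycle.exists_perm [Fintype V] [DecidableEq V] {u : V} {c : G.Walk u u}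
    (hc : c.IsCycle) :
    ∃ σ : Equiv.Perm V, σ.IsCycle ∧ σ.support = c.support.toFinset ∧
      σ.support.card = c.length ∧ ∀ j < c.length, σ (c.getVert j) = c.getVert (j + 1) := by
  have hnd := hc.support_nodup
  have hlen : c.support.tail.length = c.length := by simp
  have h3 := hc.three_le_length
  have hget : ∀ (i : ℕ) (h : i < c.support.tail.length),
      c.support.tail[i] = c.getVert (i + 1) := by
    intro i h
    rw [List.getElem_tail, Walk.support_getElem_eq_getVert]
  have hsupp : c.support.tail.formPerm.support = c.support.tail.toFinset := by
    refine List.support_formPerm_of_nodup _ hnd fun x hx => ?_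
    rw [hx, List.length_singleton] at hlen
    omega
  -- The tail lists each vertex once, with the base point last; its entry `i` is `c.getVert (i +
  -- 1)`, so position `0` of `c` is handled as the last entry.
  refine ⟨c.support.tail.formPerm, List.isCycle_formPerm hnd (by omega), ?_, ?_, ?_⟩
  · rw [hsupp]
    ext x
    rw [List.mem_toFinset, List.mem_toFinset, Walk.mem_support_iff]
    refine ⟨Or.inr, fun h => h.elim (fun h => ?_) id⟩
    rw [h]
    exact Walk.end_mem_tail_support hc.not_nil
  · rw [hsupp, List.toFinset_card_of_nodup hnd, hlen]
  · have hstep : ∀ i < c.length, c.support.tail.formPerm (c.getVert (i + 1)) =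
        c.getVert ((i + 1) % c.length + 1) := by
      intro i hi
      have := List.formPerm_apply_getElem _ hnd i (by omega)
      rw [hget, hget] at this
      rw [this, hlen]
    intro j hj
    rcases Nat.eq_zero_or_pos j with rfl | hj0
    · have := hstep (c.length - 1) (by omega)
      rw [Nat.sub_add_cancel (by omega), Nat.mod_self, Walk.getVert_length] at this
      rw [Walk.getVert_zero]
      exact this
    · have := hstep (j - 1) (by omega)
      rwa [Nat.sub_add_cancel hj0, Nat.mod_eq_of_lt hj] at this

end SimpleGraph

/-! ### Comparing real eigenvalues on a cycle -/

namespace SignPattern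

variable {n : ℕ} {P : SignPattern n}

theorem abs_eq_of_mem_roots {s : SignType} (hs : s ≠ 0) {m : ℕ} (hm : m ≠ 0) {t : ℝ} (ht : 0 < t)
    {x : ℝ} (hx : x ∈ (X ^ m - C ((s : ℝ) * t ^ m) : ℝ[X]).roots) : |x| = t := by
  have hx' := (mem_roots'.1 hx).2
  have h : aeval (x : ℂ) (X ^ m - C ((s : ℝ) * t ^ m)) = 0 := by
    rw [← Complex.coe_algebraMap, aeval_algebraMap_apply, coe_aeval_eq_eval, hx', map_zero]
  simpa using norm_eq_of_aeval_eq_zero hs hm ht h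

theorem nodup_roots_X_pow_sub {s : SignType} (hs : s ≠ 0) {m : ℕ} (hm : m ≠ 0) {t : ℝ}
    (ht : 0 < t) : (X ^ m - C ((s : ℝ) * t ^ m) : ℝ[X]).roots.Nodup := by
  refine nodup_roots (separable_X_pow_sub_C _ (Nat.cast_ne_zero.2 hm) (mul_ne_zero ?_ ?_))
  · revert hs
    cases s <;> simp
  · exact pow_ne_zero _ ht.ne'

theorem card_roots_X_pow_sub_le_two {s : SignType} (hs : s ≠ 0) {m : ℕ} (hm : m ≠ 0) {t : ℝ}
    (ht : 0 < t) : Multiset.card (X ^ m - C ((s : ℝ) * t ^ m) : ℝ[X]).roots ≤ 2 := by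
  rw [← Multiset.toFinset_card_of_nodup (nodup_roots_X_pow_sub hs hm ht)]
  refine (Finset.card_le_card (t := {t, -t}) fun x hx => ?_).trans Finset.card_le_two
  rw [Multiset.mem_toFinset] at hx
  rw [Finset.mem_insert, Finset.mem_singleton]
  exact eq_or_eq_neg_of_abs_eq (abs_eq_of_mem_roots hs hm ht hx)

theorem card_roots_X_pow_sub_le_one {s : SignType} (hs : s ≠ 0) {m : ℕ} (hm : Odd m) {t : ℝ}
    (ht : 0 < t) : Multiset.card (X ^ m - C ((s : ℝ) * t ^ m) : ℝ[X]).roots ≤ 1 := by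
  have hm0 : m ≠ 0 := hm.pos.ne'
  rw [← Multiset.toFinset_card_of_nodup (nodup_roots_X_pow_sub hs hm0 ht), Finset.card_le_one]
  intro x hx y hy
  have hx' := (mem_roots'.1 (Multiset.mem_toFinset.1 hx)).2
  have hy' := (mem_roots'.1 (Multiset.mem_toFinset.1 hy)).2
  simp only [IsRoot.def, eval_sub, eval_pow, eval_X, eval_C, sub_eq_zero] at hx' hy'
  exact hm.strictMono_pow.injective (hx'.trans hy'.symm)

theorem card_roots_X_pow_sub_neg {m : ℕ} (hm : Even m) {t : ℝ} (ht : 0 < t) :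
    Multiset.card (X ^ m - C (((-1 : SignType) : ℝ) * t ^ m) : ℝ[X]).roots = 0 := by
  rw [Multiset.card_eq_zero, Multiset.eq_zero_iff_forall_notMem]
  intro x hx
  have hx' := (mem_roots'.1 hx).2
  simp only [IsRoot.def, eval_sub, eval_pow, eval_X, eval_C, sub_eq_zero,
    SignType.coe_neg_one, neg_one_mul] at hx'
  have h1 := hm.pow_nonneg x
  have h2 := pow_pos ht m
  linarith

/-- A positive edge contributes two real eigenvalues. -/
theorem realizable_positive_edge {u v : Fin n} (huv : P.graph.Adj u v)
    (hpos : P.edgeSign s(u, v) = 1) : P.Realizable 2 {u, v} := by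
  have hne := huv.ne
  have hcyc : (Equiv.swap u v).IsCycle := Equiv.Perm.isCycle_swap hne
  have hsupp : (Equiv.swap u v).support = {u, v} := Equiv.Perm.support_swap hne
  have hcard : (Equiv.swap u v).support.card = 2 := Equiv.Perm.card_support_swap hne
  have hadj : P.MovesAlongEdges (Equiv.swap u v) := by
    intro i hi
    have hi' : i ∈ (Equiv.swap u v).support := Equiv.Perm.mem_support.2 hi
    rw [hsupp, Finset.mem_insert, Finset.mem_singleton] at hi'
    rcases hi' with rfl | rfl
    · rw [Equiv.swap_apply_left]
      exact huv
    · rw [Equiv.swap_apply_right]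
      exact huv.symm
  have hsign : P.cycleSign (Equiv.swap u v) = 1 := by
    rw [cycleSign, hsupp, Finset.prod_pair hne, Equiv.swap_apply_left, Equiv.swap_apply_right]
    exact hpos
  intro M
  have ht : 0 < |M| + 1 := by positivity
  have hR := realizes_cycle hcyc hadj ht
  rw [hsign, hcard, hsupp] at hR
  refine ⟨_, hR, fun z hz => ?_, ?_⟩
  · rw [norm_eq_of_aeval_eq_zero one_ne_zero two_ne_zero ht hz]
    linarith [le_abs_self M]
  · have hnt : |M| + 1 ≠ -(|M| + 1) := by linarith
    refine le_trans ?_ (Multiset.toFinset_card_le _)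
    refine (Finset.card_pair hnt).symm.le.trans (Finset.card_le_card fun x hx => ?_)
    rw [Multiset.mem_toFinset, mem_roots hR.1.ne_zero]
    rw [Finset.mem_insert, Finset.mem_singleton] at hx
    rcases hx with rfl | rfl
    · simp
    · simp only [IsRoot.def, eval_sub, eval_pow, eval_X, eval_C, SignType.coe_one]
      ring

/-- A pattern is not consistent if a directed cycle has fewer real eigenvalues than some
subordinate matrix on its vertices. -/
theorem not_isConsistent_of_card_roots_lt {σ : Equiv.Perm (Fin n)} (hσ : σ.IsCycle)
    (hadj : P.MovesAlongEdges σ) (hrest : P.Realizable 0 σ.supportᶜ) {e : ℕ} {T : Finset (Fin n)}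
    (hT : P.Realizable e T) (hTσ : T ⊆ σ.support)
    (hlt : ∀ t : ℝ, 0 < t → Multiset.card (X ^ σ.support.card -
      C ((P.cycleSign σ : ℝ) * t ^ σ.support.card) : ℝ[X]).roots < e) : ¬ P.IsConsistent := by
  rintro ⟨k, -, hk⟩
  have hm : σ.support.card ≠ 0 := by have := hσ.two_le_card_support; omega
  obtain ⟨q, hq, -, -⟩ := hrest 0
  -- One polynomial `q` for the complement serves both matrices, so its real roots cancel; the
  -- spectra on the cycle and on `T` are placed outside radius `M`.
  obtain ⟨M, hM, hqM⟩ := exists_norm_roots_le hq.1.ne_zero 0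
  obtain ⟨g, hg, hgM, hge⟩ := hT M
  have ht : 0 < M + 1 := by linarith
  have hf := realizes_cycle hσ hadj ht
  have hup := hq.union hf (disjoint_compl_left (a := σ.support))
    (isCoprime_of_norm_roots hqM fun z hz => by
      rw [norm_eq_of_aeval_eq_zero hadj.cycleSign_ne_zero hm ht hz]
      linarith)
  have hlow := hq.union hg ((disjoint_compl_left (a := σ.support)).mono_right hTσ)
    (isCoprime_of_norm_roots hqM hgM)
  rw [Finset.union_comm, Finset.union_compl] at hup
  have h1 := hk.le_card_roots hup
  have h2 := hk.card_roots_le hlow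
  rw [roots_mul hup.1.ne_zero, Multiset.card_add] at h1
  rw [roots_mul hlow.1.ne_zero, Multiset.card_add] at h2
  have h3 := hlt _ ht
  omega

theorem movesAlongEdges_of_getVert {u : Fin n} {c : P.graph.Walk u u} (hc : c.IsCycle)
    {σ : Equiv.Perm (Fin n)} (hsupp : σ.support = c.support.toFinset)
    (hget : ∀ j < c.length, σ (c.getVert j) = c.getVert (j + 1)) : P.MovesAlongEdges σ := by
  intro i hi
  have hi' : i ∈ c.support := by
    rw [← List.mem_toFinset, ← hsupp]
    exact Equiv.Perm.mem_support.2 hi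
  have h3 := hc.three_le_length
  obtain ⟨j, rfl, hj⟩ := SimpleGraph.Walk.mem_support_iff_exists_getVert.1 hi'
  rcases hj.lt_or_eq with hlt | rfl
  · rw [hget j hlt]
    exact c.adj_getVert_succ hlt
  · have h0 := hget 0 (by omega)
    rw [SimpleGraph.Walk.getVert_zero] at h0
    rw [SimpleGraph.Walk.getVert_length, h0]
    have := c.adj_getVert_succ (i := 0) (by omega)
    rwa [SimpleGraph.Walk.getVert_zero] at this

/-- The vertices outside a cycle are covered by disjoint cycles and edges. -/
theorem realizable_compl_cycle (hG : P.graph.OddCycleDist)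
    (hdeg : ∀ v w, P.graph.Adj v w → ∃ w', P.graph.Adj v w' ∧ w' ≠ w)
    (hdeg' : ∀ v, ∃ w, P.graph.Adj v w) {u : Fin n} {c : P.graph.Walk u u} (hc : c.IsCycle) :
    P.Realizable 0 c.support.toFinsetᶜ := by
  classical
  obtain ⟨τ, hτ, hτadj⟩ := hG.exists_matching_perm hdeg hdeg'
  -- Indexing by vertex sets identifies walks around the same cycle with different base points or
  -- directions.
  let F : Finset (Finset (Fin n)) := Finset.univ.filter fun S =>
    S ≠ c.support.toFinset ∧
      ∃ (x : Fin n) (d : P.graph.Walk x x), d.IsCycle ∧ d.support.toFinset = S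
  have hmeet : ∀ {x y v : Fin n} {d : P.graph.Walk x x} {d' : P.graph.Walk y y}, d.IsCycle →
      d'.IsCycle → v ∈ d.support → v ∈ d'.support → d.support.toFinset = d'.support.toFinset := by
    intro x y v d d' hd hd' hv hv'
    have h := hG.toSubgraph_eq hd hd' hv hv'
    ext w
    rw [List.mem_toFinset, List.mem_toFinset, ← SimpleGraph.Walk.mem_verts_toSubgraph, h,
      SimpleGraph.Walk.mem_verts_toSubgraph]
  have hF : P.Realizable 0 (F.biUnion id) := by
    refine Realizable.biUnion F id ?_ ?_
    · intro S hS
      obtain ⟨-, x, d, hd, rfl⟩ := (Finset.mem_filter.1 hS).2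
      obtain ⟨σ, -, hσ, -, hget⟩ := hd.exists_perm
      have := (movesAlongEdges_of_getVert hd hσ hget).realizable
      rwa [hσ] at this
    · intro S hS T hT hne
      obtain ⟨-, x, d, hd, rfl⟩ := (Finset.mem_filter.1 hS).2
      obtain ⟨-, y, d', hd', rfl⟩ := (Finset.mem_filter.1 hT).2
      rw [Function.onFun, id, id, Finset.disjoint_left]
      intro v hv hv'
      exact hne (hmeet hd hd' (List.mem_toFinset.1 hv) (List.mem_toFinset.1 hv'))
  have hU : P.Realizable 0 τ.support :=
    MovesAlongEdges.realizable (fun v hv => hτadj v hv)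
  have hunion : c.support.toFinsetᶜ = τ.support ∪ F.biUnion id := by
    ext v
    rw [Finset.mem_compl, Finset.mem_union, Equiv.Perm.mem_support, hτ, Finset.mem_biUnion]
    constructor
    · intro hv
      by_cases hvc : P.graph.OnCycle v
      · obtain ⟨x, d, hd, hvd⟩ := hvc
        refine Or.inr ⟨d.support.toFinset, Finset.mem_filter.2 ⟨Finset.mem_univ _, ?_, x, d, hd,
          rfl⟩, List.mem_toFinset.2 hvd⟩
        intro h
        exact hv (h ▸ List.mem_toFinset.2 hvd)
      · exact Or.inl hvc
    · rintro (hv | ⟨S, hS, hvS⟩) hvc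
      · exact hv ⟨u, c, hc, List.mem_toFinset.1 hvc⟩
      · obtain ⟨hne, x, d, hd, rfl⟩ := (Finset.mem_filter.1 hS).2
        exact hne (hmeet hd hc (List.mem_toFinset.1 hvS) (List.mem_toFinset.1 hvc))
  rw [hunion]
  refine hU.union hF ?_
  rw [Finset.disjoint_left]
  intro v hv hvF
  rw [Equiv.Perm.mem_support, hτ] at hv
  obtain ⟨S, hS, hvS⟩ := Finset.mem_biUnion.1 hvF
  obtain ⟨-, x, d, hd, rfl⟩ := (Finset.mem_filter.1 hS).2
  exact hv ⟨x, d, hd, List.mem_toFinset.1 hvS⟩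

theorem realizable_positive_edge_of_mem_edges {u a b : Fin n} {c : P.graph.Walk u u}
    (he : s(a, b) ∈ c.edges) (hpos : P.edgeSign s(a, b) = 1) :
    P.Realizable 2 {a, b} ∧ {a, b} ⊆ c.support.toFinset := by
  refine ⟨realizable_positive_edge (c.adj_of_mem_edges he) hpos, fun x hx => ?_⟩
  rw [Finset.mem_insert, Finset.mem_singleton] at hx
  rw [List.mem_toFinset]
  rcases hx with rfl | rfl
  · exact c.fst_mem_support_of_mem_edges he
  · exact c.snd_mem_support_of_mem_edges he

theorem not_isConsistent_of_two_nonadjacent_positive {u : Fin n} {c : P.graph.Walk u u}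
    (hc : c.IsCycle) (hrest : P.Realizable 0 c.support.toFinsetᶜ)
    (h : P.HasTwoNonadjacentPositiveEdges c) : ¬ P.IsConsistent := by
  obtain ⟨e, he, f, hf, hepos, hfpos, hef⟩ := h
  induction e using Sym2.ind with | _ a b => ?_
  induction f using Sym2.ind with | _ a' b' => ?_
  obtain ⟨σ, hσ, hsupp, -, hget⟩ := hc.exists_perm
  have hadj := movesAlongEdges_of_getVert hc hsupp hget
  obtain ⟨h1, h1'⟩ := realizable_positive_edge_of_mem_edges he hepos
  obtain ⟨h2, h2'⟩ := realizable_positive_edge_of_mem_edges hf hfpos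
  have hd : Disjoint ({a, b} : Finset (Fin n)) {a', b'} := by
    rw [Finset.disjoint_left]
    intro x hx hx'
    refine hef x ⟨?_, ?_⟩
    · simpa using hx
    · simpa using hx'
  have hm : σ.support.card ≠ 0 := by have := hσ.two_le_card_support; omega
  rw [← hsupp] at hrest h1' h2'
  refine not_isConsistent_of_card_roots_lt hσ hadj hrest (h1.union h2 hd)
    (Finset.union_subset h1' h2') fun t ht => ?_
  have := card_roots_X_pow_sub_le_two hadj.cycleSign_ne_zero hm ht
  omega

theorem not_isConsistent_of_odd_length {u : Fin n} {c : P.graph.Walk u u}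
    (hc : c.IsCycle) (hrest : P.Realizable 0 c.support.toFinsetᶜ) (hodd : Odd c.length)
    (h : P.HasPositiveEdge c) : ¬ P.IsConsistent := by
  obtain ⟨e, he, hepos⟩ := h
  induction e using Sym2.ind with | _ a b => ?_
  obtain ⟨σ, hσ, hsupp, hcard, hget⟩ := hc.exists_perm
  have hadj := movesAlongEdges_of_getVert hc hsupp hget
  obtain ⟨h1, h1'⟩ := realizable_positive_edge_of_mem_edges he hepos
  rw [← hsupp] at hrest h1'
  refine not_isConsistent_of_card_roots_lt hσ hadj hrest h1 h1' fun t ht => ?_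
  have := card_roots_X_pow_sub_le_one hadj.cycleSign_ne_zero (hcard ▸ hodd) ht
  omega

/-- The two orientations together use both arcs of every edge of the cycle. -/
theorem cycleSign_mul_cycleSign_inv (σ : Equiv.Perm (Fin n)) :
    P.cycleSign σ * P.cycleSign σ⁻¹ = ∏ v ∈ σ.support, P.edgeSign s(v, σ v) := by
  have h : P.cycleSign σ⁻¹ = ∏ v ∈ σ.support, P (σ v) v := by
    rw [cycleSign, Equiv.Perm.support_inv,
      ← Equiv.Perm.prod_comp σ σ.support (fun v => P v (σ⁻¹ v)) (fun v hv => by simpa using hv)]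
    simp
  rw [h, cycleSign, ← Finset.prod_mul_distrib]
  rfl

/-- On an even cycle with exactly one positive edge one of the two orientations has a negative
sign and hence no real eigenvalues. -/
theorem not_isConsistent_of_unique_positive {σ : Equiv.Perm (Fin n)} (hσ : σ.IsCycle)
    (hadj : P.MovesAlongEdges σ) (hrest : P.Realizable 0 σ.supportᶜ) (heven : Even σ.support.card)
    {w : Fin n} (hw : w ∈ σ.support) (hpos : P.edgeSign s(w, σ w) = 1)
    (hneg : ∀ v ∈ σ.support, v ≠ w → P.edgeSign s(v, σ v) ≠ 1) : ¬ P.IsConsistent := by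
  have hprod : P.cycleSign σ * P.cycleSign σ⁻¹ = -1 := by
    rw [cycleSign_mul_cycleSign_inv, ← Finset.mul_prod_erase _ _ hw, hpos, one_mul,
      Finset.prod_congr rfl (g := fun _ => (-1 : SignType)), Finset.prod_const,
      Finset.card_erase_of_mem hw]
    · refine Odd.neg_one_pow (Nat.Even.sub_odd ?_ heven odd_one)
      exact Finset.card_pos.2 ⟨w, hw⟩
    · intro v hv
      obtain ⟨hvw, hv⟩ := Finset.mem_erase.1 hv
      have h1 := hneg v hv hvw
      have h2 : P.edgeSign s(v, σ v) ≠ 0 := (hadj v (Equiv.Perm.mem_support.1 hv)).2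
      revert h1 h2
      generalize P.edgeSign s(v, σ v) = s
      revert s
      decide
  have hor : ∀ a b : SignType, a * b = -1 → a = -1 ∨ b = -1 := by decide
  have hT := realizable_positive_edge (hadj w (Equiv.Perm.mem_support.1 hw)) hpos
  have hTs : {w, σ w} ⊆ σ.support := by
    intro x hx
    rw [Finset.mem_insert, Finset.mem_singleton] at hx
    rcases hx with rfl | rfl
    · exact hw
    · exact Equiv.Perm.apply_mem_support.2 hw
  rcases hor _ _ hprod with h | h
  · refine not_isConsistent_of_card_roots_lt hσ hadj hrest hT hTs fun t ht => ?_
    rw [h, card_roots_X_pow_sub_neg heven ht]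
    exact two_pos
  -- Here the reversed orientation is the negative one; it has the same support.
  · rw [← Equiv.Perm.support_inv] at hrest hTs heven
    refine not_isConsistent_of_card_roots_lt hσ.inv hadj.inv hrest hT hTs fun t ht => ?_
    rw [h, card_roots_X_pow_sub_neg heven ht]
    exact two_pos

/-! ### Cyclic positions of positive edges -/

theorem getVert_mod_succ {G : SimpleGraph (Fin n)} {u : Fin n} (c : G.Walk u u) (k : ℕ) :
    c.getVert ((k + 1) % c.length) = c.getVert (k % c.length + 1) := by
  rcases Nat.eq_zero_or_pos c.length with h0 | h0
  · rw [h0, Nat.mod_zero, Nat.mod_zero]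
  · have hlt := Nat.mod_lt k h0
    rcases Nat.lt_or_ge (k % c.length + 1) c.length with h | h
    · rw [← Nat.mod_add_mod, Nat.mod_eq_of_lt h]
    · have h1 : k % c.length + 1 = c.length := by omega
      rw [← Nat.mod_add_mod, h1, Nat.mod_self, SimpleGraph.Walk.getVert_zero,
        SimpleGraph.Walk.getVert_length]

theorem getVert_mod_inj {G : SimpleGraph (Fin n)} {u : Fin n} {c : G.Walk u u} (hc : c.IsCycle)
    {k l : ℕ} : c.getVert (k % c.length) = c.getVert (l % c.length) ↔ k ≡ l [MOD c.length] := by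
  have h3 := hc.three_le_length
  refine ⟨fun h => ?_, fun h => by rw [h]⟩
  have hk := Nat.mod_lt k (show 0 < c.length by omega)
  have hl := Nat.mod_lt l (show 0 < c.length by omega)
  exact hc.getVert_injOn' (by simp only [Set.mem_ofPred_eq]; omega)
    (by simp only [Set.mem_ofPred_eq]; omega) h

theorem cyclicEdge_mem_edges {G : SimpleGraph (Fin n)} {u : Fin n} {c : G.Walk u u}
    (hc : c.IsCycle) (k : ℕ) : cyclicEdge c k ∈ c.edges := by
  have h3 := hc.three_le_length
  have h := c.toSubgraph_adj_getVert (Nat.mod_lt k (show 0 < c.length by omega))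
  rw [← SimpleGraph.Subgraph.mem_edgeSet, SimpleGraph.Walk.mem_edges_toSubgraph] at h
  exact h

theorem cyclicEdge_congr {G : SimpleGraph (Fin n)} {u : Fin n} {c : G.Walk u u}
    {k l : ℕ} (h : k ≡ l [MOD c.length]) : cyclicEdge c k = cyclicEdge c l := by
  rw [cyclicEdge, cyclicEdge, h]

/-- If no two positive edges of a cycle are nonadjacent, then the positions of positive edges
are cyclically equal or neighbouring. -/
theorem modEq_of_not_hasTwoNonadjacentPositiveEdges {u : Fin n} {c : P.graph.Walk u u}
    (hc : c.IsCycle) (h : ¬ P.HasTwoNonadjacentPositiveEdges c) {k l : ℕ}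
    (hk : P.edgeSign (cyclicEdge c k) = 1) (hl : P.edgeSign (cyclicEdge c l) = 1) :
    k ≡ l [MOD c.length] ∨ k ≡ l + 1 [MOD c.length] ∨ k + 1 ≡ l [MOD c.length] := by
  have h1 : ∃ v, v ∈ cyclicEdge c k ∧ v ∈ cyclicEdge c l := by
    by_contra hcon
    exact h ⟨_, cyclicEdge_mem_edges hc k, _, cyclicEdge_mem_edges hc l, hk, hl,
      fun v hv => hcon ⟨v, hv⟩⟩
  obtain ⟨v, hvk, hvl⟩ := h1
  rw [cyclicEdge, ← getVert_mod_succ, Sym2.mem_iff] at hvk hvl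
  rcases hvk with rfl | rfl <;> rcases hvl with hv | hv <;> rw [getVert_mod_inj hc] at hv
  · exact Or.inl hv
  · exact Or.inr (Or.inl hv)
  · exact Or.inr (Or.inr hv)
  · exact Or.inl (Nat.ModEq.add_right_cancel' 1 hv)

/-- An even cycle without two nonadjacent positive edges but with a maximal signed path of odd
length has exactly one positive edge. -/
theorem exists_unique_positive_position {u : Fin n} {c : P.graph.Walk u u} (hc : c.IsCycle)
    (heven : Even c.length) (h : ¬ P.HasTwoNonadjacentPositiveEdges c) {i m : ℕ} (hm : Odd m)
    (hmax : P.IsMaximalSignedPath c i m) :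
    ∃ p, P.edgeSign (cyclicEdge c p) = 1 ∧
      ∀ k, P.edgeSign (cyclicEdge c k) = 1 → k ≡ p [MOD c.length] := by
  have h3 := hc.three_le_length
  obtain ⟨hi, hm0, hmL, s, hs, hprev, hnext⟩ := hmax
  rw [Nat.odd_iff] at hm
  rw [Nat.even_iff] at heven
  have hne0 : ∀ k, P.edgeSign (cyclicEdge c k) ≠ 0 := by
    intro k
    have := c.adj_of_mem_edges (cyclicEdge_mem_edges hc k)
    exact this.2
  have hL : c.length ≡ 0 [MOD c.length] := by simp [Nat.ModEq]
  by_cases hs1 : s = 1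
  · subst hs1
    have hm1 : m = 1 := by
      -- Otherwise `m ≥ 3`, and positions `i` and `i + 2` carry nonadjacent positive edges because
      -- the even length is at least four.
      by_contra hm1
      rcases modEq_of_not_hasTwoNonadjacentPositiveEdges hc h (hs 2 (by omega)) (hs 0 hm0)
        with h1 | h1 | h1
      · have := (Nat.ModEq.add_left_cancel' i h1).eq_of_lt_of_lt (by omega) (by omega)
        omega
      · have := (Nat.ModEq.add_left_cancel' i h1).eq_of_lt_of_lt (by omega) (by omega)
        omega
      · rw [add_assoc] at h1
        have := (Nat.ModEq.add_left_cancel' i h1).eq_of_lt_of_lt (by omega) (by omega)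
        omega
    subst hm1
    refine ⟨i, hs 0 one_pos, fun k hk => ?_⟩
    rcases modEq_of_not_hasTwoNonadjacentPositiveEdges hc h hk (hs 0 one_pos) with h1 | h1 | h1
    · exact h1
    · rw [cyclicEdge_congr h1] at hk
      exact absurd hk hnext
    · refine absurd ?_ hprev
      rw [← hk]
      refine congrArg _ (cyclicEdge_congr (Nat.ModEq.add_right_cancel' 1 ?_))
      rw [add_assoc, Nat.sub_add_cancel (by omega)]
      exact (hL.add_left i).trans h1.symm
  · have hpos : ∀ r : SignType, r ≠ 0 → s ≠ 0 → r ≠ s → r = 1 := by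
      revert hs1
      generalize s = s'
      revert s'
      decide
    have hs0 : s ≠ 0 := by
      rw [← hs 0 hm0]
      exact hne0 _
    have hp := hpos _ (hne0 _) hs0 hprev
    have hq := hpos _ (hne0 _) hs0 hnext
    -- The edges before and after the negative path are positive, hence equal or adjacent. If
    -- adjacent, `m` would be a multiple of the length or the even number `c.length - 2`; so they
    -- coincide.
    have hmL1 : m = c.length - 1 := by
      by_contra hmne
      rcases modEq_of_not_hasTwoNonadjacentPositiveEdges hc h hq hp with h1 | h1 | h1
      · exact hmne ((Nat.ModEq.add_left_cancel' i h1).eq_of_lt_of_lt hmL (by omega))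
      · rw [add_assoc, Nat.sub_add_cancel (by omega)] at h1
        have := ((Nat.ModEq.add_left_cancel' i h1).trans hL).eq_of_lt_of_lt hmL (by omega)
        omega
      · rw [add_assoc] at h1
        have := (Nat.ModEq.add_left_cancel' i h1).eq_of_lt_of_lt (by omega) (by omega)
        omega
    refine ⟨_, hp, fun k hk => ?_⟩
    -- The cyclic offset of `k` from `i`; offsets below `m` lie on the negative path, leaving only
    -- the last one.
    set t := (k + (c.length - i)) % c.length with ht
    have hkt : k ≡ i + t [MOD c.length] := by
      have h1 : i + t ≡ i + (k + (c.length - i)) [MOD c.length] :=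
        (Nat.mod_modEq _ _).add_left i
      rw [show i + (k + (c.length - i)) = k + c.length by omega] at h1
      exact (h1.trans (hL.add_left k)).symm
    have htL : t < c.length := Nat.mod_lt _ (by omega)
    rcases Nat.lt_or_ge t m with h1 | h1
    · rw [cyclicEdge_congr hkt, hs t h1] at hk
      exact absurd hk hs1
    · rwa [show t = c.length - 1 by omega] at hkt

theorem not_isConsistent_of_odd_maximalSignedPath {u : Fin n} {c : P.graph.Walk u u}
    (hc : c.IsCycle) (hrest : P.Realizable 0 c.support.toFinsetᶜ) {i m : ℕ} (hm : Odd m)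
    (hmax : P.IsMaximalSignedPath c i m) (hposedge : P.HasPositiveEdge c) : ¬ P.IsConsistent := by
  by_cases h : P.HasTwoNonadjacentPositiveEdges c
  · exact not_isConsistent_of_two_nonadjacent_positive hc hrest h
  rcases Nat.even_or_odd c.length with heven | hodd
  · obtain ⟨σ, hσ, hsupp, hcard, hget⟩ := hc.exists_perm
    have h3 := hc.three_le_length
    have hmod : ∀ k, k % c.length < c.length := fun k => Nat.mod_lt k (by omega)
    have hedge : ∀ k, s(c.getVert (k % c.length), σ (c.getVert (k % c.length))) =
        cyclicEdge c k := by
      intro k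
      rw [hget _ (hmod k), cyclicEdge]
    obtain ⟨p, hp, huniq⟩ := exists_unique_positive_position hc heven h hm hmax
    rw [← hsupp] at hrest
    refine not_isConsistent_of_unique_positive hσ (movesAlongEdges_of_getVert hc hsupp hget) hrest
      (hcard ▸ heven) (w := c.getVert (p % c.length)) ?_ (by rw [hedge]; exact hp) ?_
    · rw [hsupp, List.mem_toFinset]
      exact c.getVert_mem_support _
    · intro v hv hne hv1
      rw [hsupp, List.mem_toFinset] at hv
      obtain ⟨j, rfl, hj⟩ := SimpleGraph.Walk.mem_support_iff_exists_getVert.1 hv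
      have hj' : c.getVert j = c.getVert (j % c.length) := by
        rcases hj.lt_or_eq with hlt | rfl
        · rw [Nat.mod_eq_of_lt hlt]
        · rw [Nat.mod_self, SimpleGraph.Walk.getVert_zero, SimpleGraph.Walk.getVert_length]
      rw [hj'] at hne hv1
      rw [hedge] at hv1
      exact hne ((getVert_mod_inj hc).2 (huniq j hv1))
  · exact not_isConsistent_of_odd_length hc hrest hodd hposedge

/-- An edge of the path and the edge following it have different nonzero signs, so one of them is
positive. -/
theorem IsMaximalSignedPath.hasPositiveEdge {u : Fin n} {c : P.graph.Walk u u} (hc : c.IsCycle)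
    {i m : ℕ} (hmax : P.IsMaximalSignedPath c i m) : P.HasPositiveEdge c := by
  obtain ⟨-, hm0, -, s, hs, -, hnext⟩ := hmax
  have hne0 : ∀ k, P.edgeSign (cyclicEdge c k) ≠ 0 := fun k =>
    (c.adj_of_mem_edges (cyclicEdge_mem_edges hc k)).2
  have hdec : ∀ a b : SignType, a ≠ 0 → b ≠ 0 → b ≠ a → a = 1 ∨ b = 1 := by decide
  have hs' := hs 0 hm0
  rcases hdec _ _ (hne0 _) (hne0 _) (hs'.symm ▸ hnext) with h | h
  · exact ⟨_, cyclicEdge_mem_edges hc _, h⟩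
  · exact ⟨_, cyclicEdge_mem_edges hc _, h⟩

theorem exists_adj (hirr : P.IsIrreducible) (hsymm : P.IsCombinatoriallySymmetric)
    (hn : 2 ≤ n) (v : Fin n) : ∃ w, P.graph.Adj v w := by
  have hne : ({v} : Set (Fin n)) ≠ Set.univ := by
    intro h
    have : Subsingleton (Fin n) := by
      rw [← Set.subsingleton_univ_iff, ← h]
      exact Set.subsingleton_singleton
    have h1 := Fintype.card_le_one_iff_subsingleton.2 this
    rw [Fintype.card_fin] at h1
    omega
  obtain ⟨i, hi, j, hj, hij⟩ := hirr {v} (Set.singleton_nonempty v) hne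
  rw [Set.mem_singleton_iff] at hi hj
  subst hi
  exact ⟨j, fun h => hj h.symm, mul_ne_zero hij ((hsymm i j).1 hij)⟩

end SignPattern

theorem theorem4p6 (n : ℕ) (P : SignPattern n)
    (hirr : P.IsIrreducible)
    (hsymm : P.IsCombinatoriallySymmetric)
    (hdiag : P.HasZeroDiagonal)
    (hcycle : ∃ (u : Fin n) (c : P.graph.Walk u u), c.IsCycle)
    (hleaf : ∀ v : Fin n, P.graph.degree v ≠ 1)
    (hdist : ∀ (a b : Fin n) (c₁ : P.graph.Walk a a) (c₂ : P.graph.Walk b b),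
      c₁.IsCycle → c₂.IsCycle → SimpleGraph.PathAdjacent c₁ c₂ →
        Odd (SimpleGraph.cycleDist c₁ c₂))
    (h : (∃ (u : Fin n) (c : P.graph.Walk u u),
            c.IsCycle ∧ P.HasTwoNonadjacentPositiveEdges c) ∨
         (∃ (u : Fin n) (c : P.graph.Walk u u),
            c.IsCycle ∧ P.HasTwoOddMaximalSignedPaths c) ∨
         (∃ (u : Fin n) (c : P.graph.Walk u u),
            c.IsCycle ∧ Odd c.length ∧ P.HasPositiveEdge c)) :
    ¬ P.IsConsistent := by
  have hn : 2 ≤ n := by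
    obtain ⟨u, c, hc⟩ := hcycle
    obtain ⟨σ, hσ, -⟩ := hc.exists_perm
    have h1 := hσ.two_le_card_support
    have h2 := σ.support.card_le_univ
    rw [Fintype.card_fin] at h2
    omega
  have hdeg' := SignPattern.exists_adj hirr hsymm hn
  have hdeg : ∀ v w, P.graph.Adj v w → ∃ w', P.graph.Adj v w' ∧ w' ≠ w := by
    intro v w hvw
    by_contra! hcon
    refine hleaf v (Finset.card_eq_one.2 ⟨w, ?_⟩)
    ext x
    rw [SimpleGraph.mem_neighborFinset, Finset.mem_singleton]
    exact ⟨hcon x, fun hx => hx ▸ hvw⟩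
  rcases h with ⟨u, c, hc, h⟩ | ⟨u, c, hc, i, -, m, -, -, hm, -, hmax, -⟩ | ⟨u, c, hc, hodd, h⟩
  · exact SignPattern.not_isConsistent_of_two_nonadjacent_positive hc
      (SignPattern.realizable_compl_cycle hdist hdeg hdeg' hc) h
  · exact SignPattern.not_isConsistent_of_odd_maximalSignedPath hc
      (SignPattern.realizable_compl_cycle hdist hdeg hdeg' hc) hm hmax (hmax.hasPositiveEdge hc)
  · exact SignPattern.not_isConsistent_of_odd_length hc
      (SignPattern.realizable_compl_cycle hdist hdeg hdeg' hc) hodd h
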